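/- Let $(X,\mu)$ be a measure space and $A=L^\infty(X,\mu)$ (complex functions, modulo null sets). Let $l^2(A)$ be the module of all sequences $(x_i)_{i\in\mathbb N}$ in $A$ for which $\sum_i x_ix_i^*$ converges in norm, and let $H=(l^2(A))'$ be the module of all sequences $(x_i)_{i\in\mathbb N}$ in $A$ with $\sup_n\|\sum_{i<n}x_ix_i^*\|<\infty$, with the $A$-valued inner product $\langle x,y\rangle=\sum_i x_iy_i^*$ (the series converges almost everywhere) and the norm $\|x\|=\|\langle x,x\rangle\|^{1/2}$. Let $\mathrm{End}_A(H)$ be the algebra of all bounded $A$-linear operators on $H$, with the operator norm. Then: (a) $H$ is the $A$-dual of $l^2(A)$: every bounded $A$-linear map $r:l^2(A)\to A$ is of the form $r=\langle\cdot,y\rangle$ for exactly one $y\in H$, and for every $y\in H$ the map $\langle\cdot,y\rangle$ on $l^2(A)$ is bounded with norm $\|y\|$. (b) If $\mu$ is $\sigma$-finite, then the operators of multiplication by elements of $A$ form a von Neumann algebra on $L^2(X,\mu)$, to which $A$ is $*$-isomorphic by $a\mapsto(f\mapsto af)$. (c) $\mathrm{End}_A(H)=\mathrm{End}_{\mathbb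 C}(l^2)\,\overline\otimes\,A$, the W*-tensor product. That is: whenever $A$ is a W*-algebra, realized through a $*$-isomorphism $\pi:A\to N$ onto a von Neumann algebra $N$ on a Hilbert space $K$, there is an isometric algebra isomorphism $\Phi$ from $\mathrm{End}_A(H)$ onto the von Neumann algebra $\mathrm{End}_{\mathbb C}(l^2)\,\overline\otimes\,N$ on the Hilbert space tensor product $l^2\otimes K$ generated by all $S\otimes R$ with $S\in\mathrm{End}_{\mathbb C}(l^2)$ and $R\in N$, such that - for all $S,T\in\mathrm{End}_A(H)$ one has $\Phi(S)=\Phi(T)^*$ if and only if $\langle Sx,y\rangle=\langle x,Ty\rangle$ for all $x,y\in H$; in particular every $T\in\mathrm{End}_A(H)$ has an adjoint $T^*$ in $\mathrm{End}_A(H)$, and $\Phi$ is a $*$-isomorphism; - $\langle\Phi(T)(e_j\otimes w),\,e_i\otimes v\rangle=\langle\pi((T\varepsilon_j)_i)\,w,\,v\rangle$ for all $T\in\mathrm{End}_A(H)$, all $i,j\in\mathbb N$ and all $v,w\in K$, where $(e_j)$ is the standard basis of $l^2$ and $\varepsilon_j\in H$ is the sequence with entry $1$ at place $j$ and $0$ elsewhere.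 -/

import Mathlib

open MeasureTheory Filter Topology
open scoped ENNReal TensorProduct ComplexConjugate

/-! ### The C*-algebra `L^∞(X, μ)` -/

/-- The space of classes of essentially bounded complex functions modulo null sets, with the
essential supremum norm. -/
abbrev Linfty {X : Type*} [MeasurableSpace X] (μ : Measure X) : Type _ := Lp ℂ ∞ μ

namespace Linfty

variable {X : Type*} [MeasurableSpace X] {μ : Measure X}

theorem norm_le_iff {f : Linfty μ} {C : ℝ} (hC : 0 ≤ C) :
    ‖f‖ ≤ C ↔ ∀ᵐ t ∂μ, ‖f t‖ ≤ C := by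
  constructor
  · intro h
    have h1 := enorm_ae_le_eLpNormEssSup (f : X → ℂ) μ
    filter_upwards [h1] with t ht
    rw [← eLpNorm_exponent_top, ← Lp.enorm_def] at ht
    have : ‖f t‖ ≤ ‖f‖ := enorm_le_iff_norm_le.1 ht
    exact this.trans h
  · intro h
    rw [Lp.norm_def]
    refine ENNReal.toReal_le_of_le_ofReal hC ?_
    rw [eLpNorm_exponent_top]
    exact eLpNormEssSup_le_of_ae_bound h

theorem ae_norm_le (f : Linfty μ) : ∀ᵐ t ∂μ, ‖f t‖ ≤ ‖f‖ :=
  (norm_le_iff (norm_nonneg f)).1 le_rfl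

theorem memLp_mul (f g : Linfty μ) : MemLp (fun t => f t * g t) ∞ μ :=
  (Lp.memLp g).mul (Lp.memLp f)

/-- Pointwise multiplication. -/
noncomputable instance : Mul (Linfty μ) := ⟨fun f g => (memLp_mul f g).toLp⟩

/-- The constant function one. -/
noncomputable instance : One (Linfty μ) :=
  ⟨(memLp_top_of_bound (f := fun _ : X => (1 : ℂ)) aestronglyMeasurable_const 1 (by simp)).toLp⟩

theorem coeFn_mul (f g : Linfty μ) : ⇑(f * g) =ᵐ[μ] fun t => f t * g t :=
  (memLp_mul f g).coeFn_toLp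

theorem coeFn_one : ⇑(1 : Linfty μ) =ᵐ[μ] fun _ => 1 := MemLp.coeFn_toLp _

theorem coeFn_star (f : Linfty μ) : ⇑(star f) =ᵐ[μ] fun t => conj (f t) := Lp.coeFn_star f

theorem mul_comm' (f g : Linfty μ) : f * g = g * f := by
  apply Lp.ext
  filter_upwards [coeFn_mul f g, coeFn_mul g f] with t h1 h2
  rw [h1, h2, mul_comm]

theorem mul_assoc' (f g h : Linfty μ) : f * g * h = f * (g * h) := by
  apply Lp.ext
  filter_upwards [coeFn_mul f g, coeFn_mul g h, coeFn_mul (f * g) h, coeFn_mul f (g * h)]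
    with t h1 h2 h3 h4
  rw [h3, h4, h1, h2, mul_assoc]

theorem mul_add' (f g h : Linfty μ) : f * (g + h) = f * g + f * h := by
  apply Lp.ext
  filter_upwards [coeFn_mul f g, coeFn_mul f h, coeFn_mul f (g + h), Lp.coeFn_add g h,
    Lp.coeFn_add (f * g) (f * h)] with t h1 h2 h3 h4 h5
  rw [h5, h3, Pi.add_apply, h1, h2, h4, Pi.add_apply, mul_add]

theorem one_mul' (f : Linfty μ) : 1 * f = f := by
  apply Lp.ext
  filter_upwards [coeFn_mul 1 f, coeFn_one (μ := μ)] with t h1 h2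
  rw [h1, h2, one_mul]

theorem zero_mul' (f : Linfty μ) : 0 * f = 0 := by
  apply Lp.ext
  filter_upwards [coeFn_mul 0 f, Lp.coeFn_zero ℂ ∞ μ] with t h1 h2
  rw [h1, h2, Pi.zero_apply, zero_mul]

theorem smul_mul' (c : ℂ) (f g : Linfty μ) : (c • f) * g = c • (f * g) := by
  apply Lp.ext
  filter_upwards [coeFn_mul (c • f) g, coeFn_mul f g, Lp.coeFn_smul c f,
    Lp.coeFn_smul c (f * g)] with t h1 h2 h3 h4
  rw [h1, h4, h3, Pi.smul_apply, Pi.smul_apply, h2, smul_mul_assoc]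

theorem norm_mul_le' (f g : Linfty μ) : ‖f * g‖ ≤ ‖f‖ * ‖g‖ := by
  rw [norm_le_iff (by positivity)]
  filter_upwards [coeFn_mul f g, ae_norm_le f, ae_norm_le g] with t h1 h2 h3
  rw [h1, norm_mul]
  gcongr

noncomputable instance : NormedCommRing (Linfty μ) where
  __ := (inferInstance : NormedAddCommGroup (Lp ℂ ∞ μ))
  mul_assoc := mul_assoc'
  mul_comm := mul_comm'
  one_mul := one_mul'
  mul_one f := by rw [mul_comm', one_mul']
  zero_mul := zero_mul'
  mul_zero f := by rw [mul_comm', zero_mul']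
  left_distrib := mul_add'
  right_distrib f g h := by rw [mul_comm', mul_add', mul_comm' h, mul_comm' h]
  norm_mul_le := norm_mul_le'

noncomputable instance : NormedAlgebra ℂ (Linfty μ) where
  __ := Algebra.ofModule smul_mul'
    (fun c f g => by rw [mul_comm', smul_mul', mul_comm'])
  norm_smul_le c f := norm_smul_le c f

noncomputable instance : StarRing (Linfty μ) where
  star_mul f g := by
    apply Lp.ext
    filter_upwards [coeFn_star (f * g), coeFn_mul f g, coeFn_star f, coeFn_star g,
      coeFn_mul (star g) (star f)] with t h1 h2 h3 h4 h5
    rw [h1, h2, h5, h3, h4, map_mul, mul_comm]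
  star_add f g := by
    apply Lp.ext
    filter_upwards [coeFn_star (f + g), Lp.coeFn_add f g, coeFn_star f, coeFn_star g,
      Lp.coeFn_add (star f) (star g)] with t h1 h2 h3 h4 h5
    rw [h1, h2, h5, Pi.add_apply, Pi.add_apply, h3, h4, map_add]

instance : StarModule ℂ (Linfty μ) where
  star_smul c f := by
    apply Lp.ext
    filter_upwards [coeFn_star (c • f), Lp.coeFn_smul c f, coeFn_star f,
      Lp.coeFn_smul (star c) (star f)] with t h1 h2 h3 h4
    rw [h1, h2, h4, Pi.smul_apply, Pi.smul_apply, h3, smul_eq_mul, smul_eq_mul, map_mul]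
    rfl

theorem norm_sq_le_of_star_mul (f : Linfty μ) : ‖f‖ * ‖f‖ ≤ ‖star f * f‖ := by
  have h : ‖f‖ ≤ √‖star f * f‖ := by
    rw [norm_le_iff (by positivity)]
    filter_upwards [ae_norm_le (star f * f), coeFn_mul (star f) f, coeFn_star f] with t h1 h2 h3
    rw [h2, h3, norm_mul, RCLike.norm_conj] at h1
    exact Real.le_sqrt_of_sq_le (by rw [sq]; exact h1)
  calc ‖f‖ * ‖f‖ ≤ √‖star f * f‖ * √‖star f * f‖ := by gcongr
    _ = _ := Real.mul_self_sqrt (norm_nonneg _)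

noncomputable instance : CommCStarAlgebra (Linfty μ) where
  norm_mul_self_le := norm_sq_le_of_star_mul

/-- The order of the C*-algebra: `f ≤ g` when `g - f` is a positive element. -/
noncomputable instance : PartialOrder (Linfty μ) := CStarAlgebra.spectralOrder _

noncomputable instance : StarOrderedRing (Linfty μ) := CStarAlgebra.spectralOrderedRing _

end Linfty

/-! ### The standard module `l²(A)` and its dual, for `A = L^∞(X, μ)` -/

theorem Linfty.norm_sum_add_le {X : Type*} [MeasurableSpace X] {μ : Measure X} (s : Finset ℕ)
    (x y : ℕ → Linfty μ) :
    ‖∑ i ∈ s, (x + y) i * star ((x + y) i)‖ ≤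
      2 * ‖∑ i ∈ s, x i * star (x i)‖ + 2 * ‖∑ i ∈ s, y i * star (y i)‖ := by
  have key : ∑ i ∈ s, (x + y) i * star ((x + y) i) ≤
      2 * (∑ i ∈ s, x i * star (x i)) + 2 * (∑ i ∈ s, y i * star (y i)) := by
    rw [Finset.mul_sum, Finset.mul_sum, ← Finset.sum_add_distrib]
    refine Finset.sum_le_sum fun i _ => ?_
    have h : 0 ≤ (x i - y i) * star (x i - y i) := mul_star_self_nonneg _
    rw [← sub_nonneg]
    convert h using 1
    simp only [Pi.add_apply, star_add, star_sub]
    ring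
  have h0 : 0 ≤ ∑ i ∈ s, (x + y) i * star ((x + y) i) :=
    Finset.sum_nonneg fun i _ => mul_star_self_nonneg _
  refine (CStarAlgebra.norm_le_norm_of_nonneg_of_le h0 key).trans ?_
  rw [two_mul, two_mul, two_mul, two_mul]
  exact (norm_add_le _ _).trans (add_le_add (norm_add_le _ _) (norm_add_le _ _))

/-- The sequences `(x i)` in `A` whose partial sums `∑_{i < n} (x i) (x i)*` are bounded in norm,
with the coordinatewise `A`-action. -/
noncomputable def boundedSeq {X : Type*} [MeasurableSpace X] (μ : Measure X) :
    Submodule (Linfty μ) (ℕ → Linfty μ) where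
  carrier := {x | ∃ C : ℝ, ∀ n : ℕ, ‖∑ i ∈ Finset.range n, x i * star (x i)‖ ≤ C}
  zero_mem' := ⟨0, by simp⟩
  add_mem' := by
    rintro x y ⟨C, hC⟩ ⟨D, hD⟩
    refine ⟨2 * C + 2 * D, fun n => ?_⟩
    have := Linfty.norm_sum_add_le (Finset.range n) x y
    linarith [hC n, hD n]
  smul_mem' := by
    rintro a x ⟨C, hC⟩
    refine ⟨‖a * star a‖ * C, fun n => ?_⟩
    have : ∑ i ∈ Finset.range n, (a • x) i * star ((a • x) i) =
        (a * star a) * ∑ i ∈ Finset.range n, x i * star (x i) := by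
      rw [Finset.mul_sum]
      refine Finset.sum_congr rfl fun i _ => ?_
      simp only [Pi.smul_apply, smul_eq_mul, star_mul]
      ring
    rw [this]
    refine (norm_mul_le _ _).trans ?_
    gcongr
    exact hC n

/-- The module `H = (l²(A))'` of all sequences in `A` whose partial sums `∑_{i < n} (x i) (x i)*`
are bounded in norm. It is a type of its own, because its topology is given by the norm of the
inner product and not by the product topology. -/
def StdDual {X : Type*} [MeasurableSpace X] (μ : Measure X) : Type _ := boundedSeq μ

namespace StdDual

variable {X : Type*} [MeasurableSpace X] {μ : Measure X}

noncomputable instance : AddCommGroup (StdDual μ) :=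
  inferInstanceAs (AddCommGroup (boundedSeq μ))

noncomputable instance : Module (Linfty μ) (StdDual μ) :=
  inferInstanceAs (Module (Linfty μ) (boundedSeq μ))

noncomputable instance : Module ℂ (StdDual μ) :=
  inferInstanceAs (Module ℂ (boundedSeq μ))

instance : IsScalarTower ℂ (Linfty μ) (StdDual μ) :=
  inferInstanceAs (IsScalarTower ℂ (Linfty μ) (boundedSeq μ))

instance : SMulCommClass ℂ (Linfty μ) (StdDual μ) :=
  inferInstanceAs (SMulCommClass ℂ (Linfty μ) (boundedSeq μ))

/-- The sequence of entries of an element of `H`. -/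
def seq (x : StdDual μ) : ℕ → Linfty μ := Subtype.val (p := (· ∈ boundedSeq μ)) x

@[ext]
theorem ext {x y : StdDual μ} (h : ∀ i, x.seq i = y.seq i) : x = y := Subtype.ext (funext h)

@[simp]
theorem seq_zero (i : ℕ) : (0 : StdDual μ).seq i = 0 := rfl

@[simp]
theorem seq_add (x y : StdDual μ) (i : ℕ) : (x + y).seq i = x.seq i + y.seq i := rfl

@[simp]
theorem seq_smul (a : Linfty μ) (x : StdDual μ) (i : ℕ) : (a • x).seq i = a * x.seq i := rfl

@[simp]
theorem seq_smul_complex (c : ℂ) (x : StdDual μ) (i : ℕ) : (c • x).seq i = c • x.seq i := rfl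

theorem ae_bound (x : StdDual μ) :
    ∃ C : ℝ, 0 ≤ C ∧ ∀ᵐ t ∂μ, ∀ n : ℕ, ∑ i ∈ Finset.range n, ‖x.seq i t‖ ^ 2 ≤ C := by
  obtain ⟨C, hC⟩ := x.2
  refine ⟨C, (norm_nonneg _).trans (hC 0), ?_⟩
  rw [ae_all_iff]
  intro n
  have h1 := Linfty.ae_norm_le (∑ i ∈ Finset.range n, x.seq i * star (x.seq i))
  have h2 := Lp.coeFn_finsetSum (Finset.range n) (fun i => x.seq i * star (x.seq i))
  have h3 : ∀ᵐ t ∂μ, ∀ i, (x.seq i * star (x.seq i)) t = ((‖x.seq i t‖ ^ 2 : ℝ) : ℂ) := by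
    rw [ae_all_iff]
    intro i
    filter_upwards [Linfty.coeFn_mul (x.seq i) (star (x.seq i)), Linfty.coeFn_star (x.seq i)]
      with t h4 h5
    rw [h4, h5, Complex.mul_conj, Complex.normSq_eq_norm_sq]
  filter_upwards [h1, h2, h3] with t h1 h2 h3
  rw [h2, Finset.sum_apply, Finset.sum_congr rfl (fun i _ => h3 i), ← Complex.ofReal_sum,
    Complex.norm_of_nonneg (Finset.sum_nonneg fun i _ => by positivity)] at h1
  exact h1.trans (hC n)

theorem ae_summable_sq (x : StdDual μ) : ∀ᵐ t ∂μ, Summable fun i => ‖x.seq i t‖ ^ 2 := by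
  obtain ⟨C, _, hC⟩ := ae_bound x
  filter_upwards [hC] with t ht
  exact summable_of_sum_range_le (fun i => by positivity) ht

theorem ae_tsum_sq_le (x : StdDual μ) :
    ∃ C : ℝ, 0 ≤ C ∧ ∀ᵐ t ∂μ, ∑' i, ‖x.seq i t‖ ^ 2 ≤ C := by
  obtain ⟨C, h0, hC⟩ := ae_bound x
  refine ⟨C, h0, ?_⟩
  filter_upwards [hC] with t ht
  exact Real.tsum_le_of_sum_range_le (fun i => by positivity) ht

theorem norm_mul_le_aux (z w : ℂ) : ‖conj z * w‖ ≤ ‖z‖ ^ 2 + ‖w‖ ^ 2 := by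
  rw [norm_mul, RCLike.norm_conj]
  nlinarith [sq_nonneg (‖z‖ - ‖w‖), sq_nonneg ‖z‖, sq_nonneg ‖w‖]

theorem ae_summable_inner (x y : StdDual μ) :
    ∀ᵐ t ∂μ, Summable fun i => conj (x.seq i t) * y.seq i t := by
  filter_upwards [ae_summable_sq x, ae_summable_sq y] with t h1 h2
  exact Summable.of_norm_bounded (h1.add h2) fun i => norm_mul_le_aux _ _

theorem memLp_inner (x y : StdDual μ) :
    MemLp (fun t => ∑' i, conj (x.seq i t) * y.seq i t) ∞ μ := by
  obtain ⟨C, _, hC⟩ := ae_tsum_sq_le x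
  obtain ⟨D, _, hD⟩ := ae_tsum_sq_le y
  refine memLp_top_of_bound ?_ (C + D) ?_
  · refine AEMeasurable.aestronglyMeasurable (AEMeasurable.tsum fun i => ?_)
    exact (Complex.continuous_conj.comp_aestronglyMeasurable
      (Lp.aestronglyMeasurable (x.seq i))).aemeasurable.mul (Lp.aestronglyMeasurable (y.seq i)).aemeasurable
  · filter_upwards [hC, hD, ae_summable_sq x, ae_summable_sq y] with t h1 h2 h3 h4
    calc ‖∑' i, conj (x.seq i t) * y.seq i t‖ ≤ ∑' i, (‖x.seq i t‖ ^ 2 + ‖y.seq i t‖ ^ 2) :=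
          tsum_of_norm_bounded (h3.add h4).hasSum fun i => norm_mul_le_aux _ _
      _ = ∑' i, ‖x.seq i t‖ ^ 2 + ∑' i, ‖y.seq i t‖ ^ 2 := h3.tsum_add h4
      _ ≤ C + D := add_le_add h1 h2

/-- The `A`-valued inner product, linear in the second variable: the class of the almost everywhere
convergent series `∑ i, (x i)* (y i)`, that is, the weak* limit of its partial sums. -/
noncomputable instance : Inner (Linfty μ) (StdDual μ) := ⟨fun x y => (memLp_inner x y).toLp⟩

/-- The norm of the inner product module. -/
noncomputable instance : Norm (StdDual μ) := ⟨fun x => √‖inner (Linfty μ) x x‖⟩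

theorem coeFn_inner (x y : StdDual μ) :
    ⇑(inner (Linfty μ) x y) =ᵐ[μ] fun t => ∑' i, conj (x.seq i t) * y.seq i t :=
  (memLp_inner x y).coeFn_toLp

theorem ae_coe_add (x y : StdDual μ) : ∀ᵐ t ∂μ, ∀ i, (x + y).seq i t = x.seq i t + y.seq i t := by
  rw [ae_all_iff]
  intro i
  exact Lp.coeFn_add (x.seq i) (y.seq i)

theorem ae_coe_smul (a : Linfty μ) (x : StdDual μ) :
    ∀ᵐ t ∂μ, ∀ i, (a • x).seq i t = a t * x.seq i t := by
  rw [ae_all_iff]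
  intro i
  exact Linfty.coeFn_mul a (x.seq i)

theorem ae_coe_smul_complex (c : ℂ) (x : StdDual μ) :
    ∀ᵐ t ∂μ, ∀ i, (c • x).seq i t = c * x.seq i t := by
  rw [ae_all_iff]
  intro i
  exact Lp.coeFn_smul c (x.seq i)

theorem inner_self_apply (x : StdDual μ) :
    ⇑(inner (Linfty μ) x x) =ᵐ[μ] fun t => ((∑' i, ‖x.seq i t‖ ^ 2 : ℝ) : ℂ) := by
  filter_upwards [coeFn_inner x x] with t ht
  rw [ht, Complex.ofReal_tsum]
  refine tsum_congr fun i => ?_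
  rw [mul_comm, Complex.mul_conj, Complex.normSq_eq_norm_sq]

theorem inner_self_nonneg' (x : StdDual μ) : 0 ≤ inner (Linfty μ) x x := by
  obtain ⟨C, _, hC⟩ := ae_tsum_sq_le x
  have hm : MemLp (fun t => ((√‖inner (Linfty μ) x x t‖ : ℝ) : ℂ)) ∞ μ := by
    refine memLp_top_of_bound ?_ (√‖inner (Linfty μ) x x‖) ?_
    · exact (Complex.continuous_ofReal.comp (Real.continuous_sqrt.comp
        continuous_norm)).comp_aestronglyMeasurable (Lp.aestronglyMeasurable _)
    · filter_upwards [Linfty.ae_norm_le (inner (Linfty μ) x x)] with t ht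
      rw [Complex.norm_of_nonneg (Real.sqrt_nonneg _)]
      exact Real.sqrt_le_sqrt ht
  have : inner (Linfty μ) x x = star hm.toLp * hm.toLp := by
    apply Lp.ext
    filter_upwards [inner_self_apply x, Linfty.coeFn_mul (star hm.toLp) hm.toLp,
      Linfty.coeFn_star hm.toLp, hm.coeFn_toLp] with t h1 h2 h3 h4
    rw [h2, h3, h4, Complex.conj_ofReal, ← Complex.ofReal_mul,
      Real.mul_self_sqrt (norm_nonneg _), h1,
      Complex.norm_of_nonneg (tsum_nonneg fun i => by positivity)]
  rw [this]
  exact star_mul_self_nonneg _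

noncomputable instance : CStarModule (Linfty μ) (StdDual μ) where
  inner_add_right {x y z} := by
    apply Lp.ext
    filter_upwards [coeFn_inner x (y + z), coeFn_inner x y, coeFn_inner x z, ae_coe_add y z,
      ae_summable_inner x y, ae_summable_inner x z,
      Lp.coeFn_add (inner (Linfty μ) x y) (inner (Linfty μ) x z)] with t h1 h2 h3 h4 h5 h6 h7
    rw [h7, Pi.add_apply, h1, h2, h3, ← h5.tsum_add h6]
    exact tsum_congr fun i => by rw [h4, mul_add]
  inner_self_nonneg {x} := inner_self_nonneg' x
  inner_self {x} := by
    constructor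
    · intro h
      ext1 i
      apply Lp.ext
      have h1 := inner_self_apply x
      rw [h] at h1
      filter_upwards [h1, Lp.coeFn_zero ℂ ∞ μ, ae_summable_sq x] with t h1 h2 h3
      rw [seq_zero]
      rw [h2] at h1 ⊢
      have h4 : ∑' i, ‖x.seq i t‖ ^ 2 = 0 := by
        rw [Pi.zero_apply] at h1; exact_mod_cast h1.symm
      have h5 := (h3.hasSum_iff.2 h4)
      rw [hasSum_zero_iff_of_nonneg (fun i => by positivity)] at h5
      have := congrFun h5 i
      simpa using this
    · rintro rfl
      apply Lp.ext
      filter_upwards [coeFn_inner (0 : StdDual μ) 0, Lp.coeFn_zero ℂ ∞ μ] with t h1 h2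
      rw [h1, h2]
      simp only [seq_zero, h2]
      simp
  inner_op_smul_right {a x y} := by
    apply Lp.ext
    filter_upwards [coeFn_inner x (a • y), coeFn_inner x y, ae_coe_smul a y,
      Linfty.coeFn_mul a (inner (Linfty μ) x y)] with t h1 h2 h3 h4
    rw [h4, h1, h2, ← tsum_mul_left]
    exact tsum_congr fun i => by rw [h3]; ring
  inner_smul_right_complex {c x y} := by
    apply Lp.ext
    filter_upwards [coeFn_inner x (c • y), coeFn_inner x y, ae_coe_smul_complex c y,
      Lp.coeFn_smul c (inner (Linfty μ) x y)] with t h1 h2 h3 h4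
    rw [h4, h1, Pi.smul_apply, h2, smul_eq_mul, ← tsum_mul_left]
    exact tsum_congr fun i => by rw [h3]; ring
  star_inner x y := by
    apply Lp.ext
    filter_upwards [coeFn_inner x y, coeFn_inner y x, Linfty.coeFn_star (inner (Linfty μ) x y)]
      with t h1 h2 h3
    rw [h3, h1, h2, Complex.conj_tsum]
    exact tsum_congr fun i => by rw [map_mul, Complex.conj_conj, mul_comm]
  norm_eq_sqrt_norm_inner_self _ := rfl

noncomputable instance : NormedAddCommGroup (StdDual μ) :=
  NormedAddCommGroup.ofCore (CStarModule.normedSpaceCore (Linfty μ))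

noncomputable instance : NormedSpace ℂ (StdDual μ) :=
  NormedSpace.ofCore (CStarModule.normedSpaceCore (Linfty μ))

/-- The sequence with entry `1` at place `j` and `0` elsewhere. -/
noncomputable def basis (μ : Measure X) (j : ℕ) : StdDual μ :=
  ⟨Pi.single j 1, ‖(1 : Linfty μ)‖, fun n => by
    have h : ∀ i, (Pi.single j 1 : ℕ → Linfty μ) i * star ((Pi.single j 1 : ℕ → Linfty μ) i) =
        Pi.single (M := fun _ => Linfty μ) j 1 i := by
      intro i
      by_cases hij : i = j
      · subst hij; simp
      · simp [hij]
    simp only [h, Finset.sum_pi_single']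
    split_ifs <;> simp⟩

end StdDual

/-- The standard countably generated module `l²(A)`: the sequences `(x i)` in `A` for which
`∑ (x i) (x i)*` converges in norm. Convergent sequences of partial sums are bounded, so this is a
submodule of the module of sequences with bounded partial sums. -/
noncomputable def StdModule {X : Type*} [MeasurableSpace X] (μ : Measure X) :
    Submodule (Linfty μ) (StdDual μ) where
  carrier := {x | ∃ s : Linfty μ,
    Tendsto (fun n => ∑ i ∈ Finset.range n, x.seq i * star (x.seq i)) atTop (𝓝 s)}
  zero_mem' := ⟨0, by simp⟩
  add_mem' := by
    rintro x y ⟨s, hs⟩ ⟨u, hu⟩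
    apply cauchySeq_tendsto_of_complete
    rw [Metric.cauchySeq_iff']
    intro ε hε
    obtain ⟨M, hM⟩ := Metric.cauchySeq_iff.1 hu.cauchySeq (ε / 4) (by positivity)
    obtain ⟨N, hN⟩ := Metric.cauchySeq_iff.1 hs.cauchySeq (ε / 4) (by positivity)
    refine ⟨max N M, fun n hn => ?_⟩
    have h1 := hN n (le_of_max_le_left hn) (max N M) (le_max_left _ _)
    have h2 := hM n (le_of_max_le_right hn) (max N M) (le_max_right _ _)
    rw [dist_eq_norm, ← Finset.sum_Ico_eq_sub _ hn] at h1 h2 ⊢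
    have := Linfty.norm_sum_add_le (Finset.Ico (max N M) n) x.seq y.seq
    refine lt_of_le_of_lt this ?_
    linarith
  smul_mem' := by
    rintro a x ⟨s, hs⟩
    refine ⟨(a * star a) * s, ?_⟩
    refine (hs.const_mul (a * star a)).congr fun n => ?_
    rw [Finset.mul_sum]
    refine Finset.sum_congr rfl fun i _ => ?_
    rw [StdDual.seq_smul, star_mul]
    ring

/-- The algebra `End_A(H)` of all bounded `A`-linear operators on `H`, where `H` is the module of
sequences with bounded partial sums. -/
noncomputable def EndA {X : Type*} [MeasurableSpace X] (μ : Measure X) :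
    Subalgebra ℂ (StdDual μ →L[ℂ] StdDual μ) where
  carrier := {T | ∀ (a : Linfty μ) (x : StdDual μ), T (a • x) = a • T x}
  mul_mem' := by
    intro S T hS hT a x
    change S (T (a • x)) = a • S (T x)
    rw [hT, hS]
  add_mem' := by
    intro S T hS hT a x
    change S (a • x) + T (a • x) = a • (S x + T x)
    rw [hT, hS, smul_add]
  algebraMap_mem' := by
    intro c a x
    change c • (a • x) = a • (c • x)
    exact smul_comm c a x

/-! ### The W*-tensor product -/

namespace VonNeumannAlgebra

variable {H K : Type*} [NormedAddCommGroup H] [InnerProductSpace ℂ H] [CompleteSpace H]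
  [NormedAddCommGroup K] [InnerProductSpace ℂ K] [CompleteSpace K]

/-- The von Neumann algebra generated by a set `s` of operators: the double commutant of
`s ∪ s*`. -/
noncomputable def generated (s : Set (H →L[ℂ] H)) : VonNeumannAlgebra H where
  toStarSubalgebra := StarSubalgebra.centralizer ℂ (StarSubalgebra.centralizer ℂ s : Set (H →L[ℂ] H))
  centralizer_centralizer' := by
    change Set.centralizer (Set.centralizer (StarSubalgebra.centralizer ℂ
      (StarSubalgebra.centralizer ℂ s : Set (H →L[ℂ] H)) : Set (H →L[ℂ] H))) =
      (StarSubalgebra.centralizer ℂ (StarSubalgebra.centralizer ℂ s : Set (H →L[ℂ] H)) :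
        Set (H →L[ℂ] H))
    simp

variable (H) in
/-- The von Neumann algebra of all bounded operators. -/
noncomputable def full : VonNeumannAlgebra H where
  toStarSubalgebra := ⊤
  centralizer_centralizer' := by
    refine Set.eq_univ_of_forall fun T => ?_
    rw [Set.mem_centralizer_iff]
    intro S hS
    exact (hS T (Set.mem_univ T)).symm

/-- The W*-tensor product of `M` acting on `H` and `N` acting on `K`: the von Neumann algebra on
the Hilbert space tensor product of `H` and `K` that is generated by the operators `S ⊗ R` with
`S ∈ M` and `R ∈ N`. -/
noncomputable def tensor (M : VonNeumannAlgebra H) (N : VonNeumannAlgebra K) :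
    VonNeumannAlgebra (UniformSpace.Completion (H ⊗[ℂ] K)) :=
  generated {T | ∃ S ∈ M, ∃ R ∈ N, T = (TensorProduct.mapL S R).completion}

end VonNeumannAlgebra

/-- The Hilbert space `l²` of square summable complex sequences. -/
abbrev l2 : Type := lp (fun _ : ℕ => ℂ) 2

/-!
Write `A = L^∞(X, μ)` and `H` for the module of sequences with bounded partial sums.

*Self-duality.* By an Egorov argument (`StdDual.exists_isExhaustion`), every `x ∈ H` is uniformly
approximated by its truncations on each set of an increasing sequence with conull union. As a module
map commutes with the indicators of these sets, a bounded module map into `A` is determined by its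
values on the standard basis (`StdDual.eq_zero_of_basis`), so that it is the inner product with the
sequence of these values (`StdDual.exists_inner_eq`). On `l²(A)` this is the duality statement; on
`H` itself it gives adjoints of module operators (`EndA.exists_adjoint`). No `σ`-finiteness is
needed.

*The multiplication algebra.* For `σ`-finite `μ` there is a square integrable `e` without zeros. An
operator `T` that commutes with multiplications is multiplication by `T e / e`, which is bounded by
`‖T‖` (`Linfty.exists_mulHom_eq`). Hence the multiplications are their own commutant.

*The tensor product.* Let `ρ` realize `A` as the von Neumann algebra `N` on `K`. A `*`-isomorphism
onto a von Neumann algebra is automatically normal; `IsRealization.tendsto_exhaustion` is the part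
of this that is needed. It allows one to attach to `x ∈ H` the operator
`creation ρ x : w ↦ ∑ k, e_k ⊗ ρ (x k) w` from `K` to `l² ⊗ K`, with
`(creation ρ x)* (creation ρ y) = ρ ⟨x, y⟩` (`inner_creation_creation`). These are exactly the
operators with coordinates in `N` (`exists_creation_eq`). An element `S` of the tensor product
commutes with `1 ⊗ N'`, so `S ∘ creation ρ x` again has coordinates in `N`; this defines a module
operator `T` with `creation ρ (T x) = S ∘ creation ρ x`. Conversely, given `T`, this formula defines
`S` on a dense subspace. It is bounded there by `‖T‖`, since `T* T` is symmetric and its powers grow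
at most like `‖T* T‖ ^ n` (`norm_le_of_symmetric_of_growth`), and its extension commutes with the
commutant `1 ⊗ N'` of the elementary tensors (`exists_commutant_of_commute`).
-/

open MeasureTheory Filter Topology
open scoped ENNReal TensorProduct ComplexConjugate

/-! ### Exhaustions of the measure space -/

namespace Linfty

variable {X : Type*} [MeasurableSpace X] {μ : Measure X}

/-- The class of the indicator function of a measurable set. -/
noncomputable def ind (μ : Measure X) {s : Set X} (hs : MeasurableSet s) : Linfty μ :=
  (memLp_top_of_bound (f := s.indicator fun _ => (1 : ℂ))
    (aestronglyMeasurable_const.indicator hs) 1 (ae_of_all _ fun t => by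
      by_cases ht : t ∈ s <;> simp [ht])).toLp

theorem coeFn_ind {s : Set X} (hs : MeasurableSet s) :
    ⇑(ind μ hs) =ᵐ[μ] s.indicator fun _ => 1 := MemLp.coeFn_toLp _

/-- A sequence in `L^∞(X, μ)` that behaves like the indicators of an increasing sequence of sets
whose union is conull. The last field says that a function that is bounded by `C` on each of the
sets is bounded by `C`. -/
structure IsExhaustion (p : ℕ → Linfty μ) : Prop where
  norm_le_one : ∀ n, ‖p n‖ ≤ 1
  mul_eq : ∀ m n, m ≤ n → p n * p m = p m
  norm_le : ∀ (a : Linfty μ) (C : ℝ), 0 ≤ C → (∀ n, ‖p n * a‖ ≤ C) → ‖a‖ ≤ C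

theorem isExhaustion_ind {s : ℕ → Set X} (hs : ∀ n, MeasurableSet (s n))
    (hmono : ∀ᵐ t ∂μ, ∀ m n, m ≤ n → t ∈ s m → t ∈ s n) (hcover : ∀ᵐ t ∂μ, ∃ n, t ∈ s n) :
    IsExhaustion fun n => ind μ (hs n) where
  norm_le_one n := by
    rw [norm_le_iff zero_le_one]
    filter_upwards [coeFn_ind (μ := μ) (hs n)] with t ht
    rw [ht]
    by_cases h : t ∈ s n <;> simp [h]
  mul_eq m n hmn := by
    apply Lp.ext
    filter_upwards [coeFn_mul (ind μ (hs n)) (ind μ (hs m)), coeFn_ind (μ := μ) (hs m),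
      coeFn_ind (μ := μ) (hs n), hmono] with t h1 h2 h3 h4
    rw [h1, h2, h3]
    by_cases h : t ∈ s m
    · simp [h, h4 m n hmn h]
    · simp [h]
  norm_le a C hC h := by
    rw [norm_le_iff hC]
    have h1 : ∀ᵐ t ∂μ, ∀ n, (ind μ (hs n) * a) t = (s n).indicator (fun _ => 1) t * a t := by
      rw [ae_all_iff]
      intro n
      filter_upwards [coeFn_mul (ind μ (hs n)) a, coeFn_ind (μ := μ) (hs n)] with t h1 h2
      rw [h1, h2]
    have h2 : ∀ᵐ t ∂μ, ∀ n, ‖(ind μ (hs n) * a) t‖ ≤ C := by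
      rw [ae_all_iff]
      exact fun n => (norm_le_iff hC).1 (h n)
    filter_upwards [h1, h2, hcover] with t h1 h2 ⟨n, hn⟩
    have := h2 n
    rwa [h1 n, Set.indicator_of_mem hn, one_mul] at this

theorem IsExhaustion.eq_zero {p : ℕ → Linfty μ} (hp : IsExhaustion p) {a : Linfty μ}
    (h : ∀ n, p n * a = 0) : a = 0 :=
  norm_le_zero_iff.1 (hp.norm_le a 0 le_rfl fun n => by rw [h n, norm_zero])

end Linfty

/-! ### Truncation of sequences -/

namespace StdDual

variable {X : Type*} [MeasurableSpace X] {μ : Measure X}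

local notation "⟪" x ", " y "⟫" => inner (Linfty μ) x y

@[simp]
theorem seq_sub (x y : StdDual μ) (i : ℕ) : (x - y).seq i = x.seq i - y.seq i := rfl

@[simp]
theorem seq_sum {ι : Type*} (s : Finset ι) (x : ι → StdDual μ) (i : ℕ) :
    (∑ k ∈ s, x k).seq i = ∑ k ∈ s, (x k).seq i :=
  map_sum (AddMonoidHom.mk' (fun x : StdDual μ => x.seq i) fun _ _ => rfl) x s

theorem seq_basis (j i : ℕ) : (basis μ j).seq i = if i = j then 1 else 0 :=
  Pi.single_apply j (1 : Linfty μ) i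

/-- The sequence with its entries from place `n` on replaced by `0`. -/
noncomputable def trunc (n : ℕ) (x : StdDual μ) : StdDual μ :=
  ∑ i ∈ Finset.range n, x.seq i • basis μ i

theorem seq_trunc (n : ℕ) (x : StdDual μ) (i : ℕ) :
    (trunc n x).seq i = if i < n then x.seq i else 0 := by
  simp [trunc, seq_basis]

protected theorem inner_add_right (x y z : StdDual μ) : ⟪x, y + z⟫ = ⟪x, y⟫ + ⟪x, z⟫ :=
  CStarModule.inner_add_right (A := Linfty μ) (E := StdDual μ)

protected theorem inner_sub_right (x y z : StdDual μ) : ⟪x, y - z⟫ = ⟪x, y⟫ - ⟪x, z⟫ :=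
  CStarModule.inner_sub_right (A := Linfty μ) (E := StdDual μ)

theorem inner_sum_right {ι : Type*} (s : Finset ι) (x : StdDual μ) (y : ι → StdDual μ) :
    ⟪x, ∑ i ∈ s, y i⟫ = ∑ i ∈ s, ⟪x, y i⟫ :=
  CStarModule.inner_sum_right (A := Linfty μ) (E := StdDual μ)

protected theorem inner_smul_right (a : Linfty μ) (x y : StdDual μ) : ⟪x, a • y⟫ = a * ⟪x, y⟫ :=
  CStarModule.inner_op_smul_right (A := Linfty μ) (E := StdDual μ)

protected theorem inner_smul_left (a : Linfty μ) (x y : StdDual μ) : ⟪a • x, y⟫ = ⟪x, y⟫ * star a :=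
  CStarModule.inner_op_smul_left (A := Linfty μ) (E := StdDual μ)

protected theorem inner_smul_right_complex (c : ℂ) (x y : StdDual μ) : ⟪x, c • y⟫ = c • ⟪x, y⟫ :=
  CStarModule.inner_smul_right_complex (A := Linfty μ) (E := StdDual μ)

protected theorem star_inner (x y : StdDual μ) : star ⟪x, y⟫ = ⟪y, x⟫ :=
  CStarModule.star_inner (A := Linfty μ) (E := StdDual μ) _ _

theorem norm_sq_eq_norm_inner (x : StdDual μ) : ‖x‖ ^ 2 = ‖⟪x, x⟫‖ := CStarModule.norm_sq_eq _

theorem norm_inner_le_mul (x y : StdDual μ) : ‖⟪x, y⟫‖ ≤ ‖x‖ * ‖y‖ :=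
  CStarModule.norm_inner_le (StdDual μ)

theorem inner_basis_left (j : ℕ) (x : StdDual μ) : ⟪basis μ j, x⟫ = x.seq j := by
  apply Lp.ext
  have h : ∀ᵐ t ∂μ, ∀ i, (basis μ j).seq i t = if i = j then 1 else 0 := by
    rw [ae_all_iff]
    intro i
    rw [seq_basis]
    split_ifs
    · exact Linfty.coeFn_one
    · exact Lp.coeFn_zero ℂ ∞ μ
  filter_upwards [coeFn_inner (basis μ j) x, h] with t h1 h2
  rw [h1, tsum_eq_single j fun i hi => by rw [h2, if_neg hi, map_zero, zero_mul], h2, if_pos rfl,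
    map_one, one_mul]

theorem inner_basis_right (j : ℕ) (x : StdDual μ) : ⟪x, basis μ j⟫ = star (x.seq j) := by
  rw [← StdDual.star_inner, inner_basis_left]

theorem eq_of_inner_left {x y : StdDual μ} (h : ∀ z, ⟪z, x⟫ = ⟪z, y⟫) : x = y := by
  ext1 i
  rw [← inner_basis_left, h, inner_basis_left]

theorem inner_trunc_right (n : ℕ) (x y : StdDual μ) :
    ⟪x, trunc n y⟫ = ∑ i ∈ Finset.range n, star (x.seq i) * y.seq i := by
  rw [trunc, StdDual.inner_sum_right]
  refine Finset.sum_congr rfl fun i _ => ?_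
  rw [StdDual.inner_smul_right, inner_basis_right, mul_comm]

theorem norm_trunc_sq (n : ℕ) (x : StdDual μ) :
    ‖trunc n x‖ ^ 2 = ‖∑ i ∈ Finset.range n, x.seq i * star (x.seq i)‖ := by
  rw [norm_sq_eq_norm_inner, inner_trunc_right]
  congr 1
  refine Finset.sum_congr rfl fun i hi => ?_
  rw [seq_trunc, if_pos (Finset.mem_range.1 hi), mul_comm]

theorem norm_trunc_le (n : ℕ) (x : StdDual μ) : ‖trunc n x‖ ≤ ‖x‖ := by
  have h1 : ⟪x, trunc n x⟫ = ⟪trunc n x, trunc n x⟫ := by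
    rw [inner_trunc_right, inner_trunc_right]
    refine Finset.sum_congr rfl fun i hi => ?_
    rw [seq_trunc, if_pos (Finset.mem_range.1 hi)]
  have h2 := norm_inner_le_mul x (trunc n x)
  rw [h1, ← norm_sq_eq_norm_inner] at h2
  by_contra! h3
  nlinarith [norm_nonneg x]

/-- The norm of a sequence is the supremum of the norms of its truncations. -/
theorem norm_le_of_norm_trunc_le {x : StdDual μ} {C : ℝ} (hC : 0 ≤ C)
    (h : ∀ n, ‖trunc n x‖ ≤ C) : ‖x‖ ≤ C := by
  refine le_of_sq_le_sq ?_ hC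
  rw [norm_sq_eq_norm_inner, Linfty.norm_le_iff (by positivity)]
  have h1 : ∀ᵐ t ∂μ, ∀ n, ∑ i ∈ Finset.range n, ‖x.seq i t‖ ^ 2 ≤ C ^ 2 := by
    rw [ae_all_iff]
    intro n
    have h2 : ‖⟪trunc n x, trunc n x⟫‖ ≤ C ^ 2 := by
      rw [← norm_sq_eq_norm_inner]
      gcongr
      exact h n
    have h3 : ∀ᵐ t ∂μ, ∀ i, (trunc n x).seq i t = if i < n then x.seq i t else 0 := by
      rw [ae_all_iff]
      intro i
      rw [seq_trunc]
      split_ifs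
      · exact ae_of_all _ fun _ => rfl
      · exact Lp.coeFn_zero ℂ ∞ μ
    filter_upwards [(Linfty.norm_le_iff (by positivity)).1 h2, inner_self_apply (trunc n x), h3]
      with t h4 h5 h6
    rw [h5, Complex.norm_of_nonneg (tsum_nonneg fun i => by positivity),
      tsum_eq_sum (s := Finset.range n) (fun i hi => by
        rw [h6, if_neg (by simpa using hi), norm_zero, zero_pow two_ne_zero])] at h4
    refine le_trans (le_of_eq (Finset.sum_congr rfl fun i hi => ?_)) h4
    rw [h6, if_pos (Finset.mem_range.1 hi)]
  filter_upwards [h1, inner_self_apply x] with t h2 h3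
  rw [h3, Complex.norm_of_nonneg (tsum_nonneg fun i => by positivity)]
  exact Real.tsum_le_of_sum_range_le (fun i => by positivity) h2

/-- An Egorov theorem: off sets that shrink to a null set, the truncations of a sequence
approximate it in norm. -/
theorem exists_isExhaustion (x : StdDual μ) {ε : ℝ} (hε : 0 < ε) :
    ∃ p : ℕ → Linfty μ, Linfty.IsExhaustion p ∧ ∀ n, ‖p n • (x - trunc n x)‖ ≤ ε := by
  have hseq : ∀ᵐ t ∂μ, ∀ n i, (x - trunc n x).seq i t = if i < n then 0 else x.seq i t := by
    simp only [ae_all_iff]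
    intro n i
    rw [seq_sub, seq_trunc]
    split_ifs
    · rw [sub_self]; exact Lp.coeFn_zero ℂ ∞ μ
    · rw [sub_zero]; exact ae_of_all _ fun _ => rfl
  have htail : ∀ᵐ t ∂μ, ∀ n, ⟪x - trunc n x, x - trunc n x⟫ t =
      ((∑' i, ‖x.seq (i + n) t‖ ^ 2 : ℝ) : ℂ) := by
    rw [ae_all_iff]
    intro n
    filter_upwards [inner_self_apply (x - trunc n x), hseq, ae_summable_sq (x - trunc n x)]
      with t h1 h2 h3
    rw [h1, ← h3.sum_add_tsum_nat_add n, Finset.sum_eq_zero, zero_add]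
    · congr 1
      refine tsum_congr fun i => ?_
      rw [h2, if_neg (by omega)]
    · intro i hi
      rw [h2, if_pos (Finset.mem_range.1 hi), norm_zero, zero_pow two_ne_zero]
  have hs : ∀ n, MeasurableSet {t | ‖⟪x - trunc n x, x - trunc n x⟫ t‖ ≤ ε ^ 2} := fun n =>
    measurableSet_le (Lp.stronglyMeasurable _).measurable.norm measurable_const
  refine ⟨fun n => Linfty.ind μ (hs n), Linfty.isExhaustion_ind hs ?_ ?_, fun n => ?_⟩
  · filter_upwards [htail, ae_summable_sq x] with t h1 h2 m n hmn h3
    simp only [h1,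
      Complex.norm_of_nonneg (tsum_nonneg fun i => sq_nonneg ‖x.seq (i + _) t‖)] at h3 ⊢
    refine le_trans ?_ h3
    have h4 := (summable_nat_add_iff (f := fun i => ‖x.seq i t‖ ^ 2) m).2 h2
    rw [← h4.sum_add_tsum_nat_add (n - m)]
    have h5 : ∀ i, i + (n - m) + m = i + n := fun i => by omega
    simp only [h5]
    exact le_add_of_nonneg_left (Finset.sum_nonneg fun i _ => by positivity)
  · filter_upwards [htail] with t h1
    have h2 := tendsto_sum_nat_add fun i => ‖x.seq i t‖ ^ 2
    obtain ⟨n, hn⟩ := (h2.eventually (eventually_le_nhds (show (0 : ℝ) < ε ^ 2 by positivity))).exists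
    refine ⟨n, ?_⟩
    rw [h1, Complex.norm_of_nonneg (tsum_nonneg fun i => by positivity)]
    exact hn
  · refine le_of_sq_le_sq ?_ hε.le
    beta_reduce
    rw [norm_sq_eq_norm_inner, StdDual.inner_smul_left, StdDual.inner_smul_right,
      Linfty.norm_le_iff (by positivity)]
    set τ := ⟪x - trunc n x, x - trunc n x⟫
    set p := Linfty.ind μ (hs n)
    filter_upwards [Linfty.coeFn_mul (p * τ) (star p), Linfty.coeFn_mul p τ, Linfty.coeFn_star p,
      Linfty.coeFn_ind (μ := μ) (hs n)] with t h1 h2 h3 h4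
    rw [h1, h2, h3, h4]
    by_cases h : t ∈ {t | ‖τ t‖ ≤ ε ^ 2}
    · rw [Set.indicator_of_mem h, one_mul, map_one, mul_one]
      exact h
    · rw [Set.indicator_of_notMem h]
      simp only [zero_mul, norm_zero]
      positivity

/-! ### Self-duality -/

/-- A bounded module map is determined by its values on the standard basis: on the sets of an
exhaustion where the tails of a sequence are uniformly small, its value is small. -/
theorem eq_zero_of_basis {S : Submodule (Linfty μ) (StdDual μ)} (hS : ∀ j, basis μ j ∈ S)
    (r : S →ₗ[Linfty μ] Linfty μ) {C : ℝ} (hr : ∀ x, ‖r x‖ ≤ C * ‖x‖)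
    (h0 : ∀ j, r ⟨basis μ j, hS j⟩ = 0) : r = 0 := by
  wlog hC : 0 ≤ C generalizing C
  · refine this (C := 0) (fun x => (hr x).trans ?_) le_rfl
    exact mul_le_mul_of_nonneg_right (not_le.1 hC).le (norm_nonneg _)
  have htrunc : ∀ n (x : StdDual μ), ∃ h : trunc n x ∈ S, r ⟨trunc n x, h⟩ = 0 := by
    intro n x
    have h1 : trunc n x =
        ((∑ i ∈ Finset.range n, x.seq i • (⟨basis μ i, hS i⟩ : S) : S) : StdDual μ) := by
      simp [trunc]
    refine ⟨h1 ▸ Subtype.property _, ?_⟩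
    have h2 : ∀ h : trunc n x ∈ S, (⟨trunc n x, h⟩ : S) =
        ∑ i ∈ Finset.range n, x.seq i • (⟨basis μ i, hS i⟩ : S) := fun _ => Subtype.ext h1
    rw [h2, map_sum]
    exact Finset.sum_eq_zero fun i _ => by rw [map_smul, h0, smul_zero]
  ext1 x
  rw [LinearMap.zero_apply, ← norm_le_zero_iff]
  refine le_of_forall_pos_le_add fun δ hδ => ?_
  rw [zero_add]
  obtain ⟨p, hp, hpx⟩ := exists_isExhaustion (x : StdDual μ) (ε := δ / (C + 1)) (by positivity)
  refine hp.norm_le _ _ hδ.le fun n => ?_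
  obtain ⟨hmem, hzero⟩ := htrunc n x
  have h1 : p n * r x = r (p n • (x - ⟨trunc n x, hmem⟩)) := by
    rw [map_smul, map_sub, hzero, sub_zero, smul_eq_mul]
  rw [h1]
  calc _ ≤ C * ‖p n • (x - ⟨trunc n x, hmem⟩)‖ := hr _
    _ ≤ C * (δ / (C + 1)) := by
        gcongr
        exact hpx n
    _ ≤ δ := by
        rw [mul_div_assoc', div_le_iff₀ (by positivity)]
        nlinarith

/-- Every bounded module map into `A` on a submodule of `H` that contains the standard basis is the
inner product with an element of `H`. -/
theorem exists_inner_eq {S : Submodule (Linfty μ) (StdDual μ)} (hS : ∀ j, basis μ j ∈ S)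
    (r : S →ₗ[Linfty μ] Linfty μ) {C : ℝ} (hr : ∀ x, ‖r x‖ ≤ C * ‖x‖) :
    ∃ y : StdDual μ, ∀ x : S, r x = ⟪y, (x : StdDual μ)⟫ := by
  wlog hC : 0 ≤ C generalizing C
  · refine this (C := 0) (fun x => (hr x).trans ?_) le_rfl
    exact mul_le_mul_of_nonneg_right (not_le.1 hC).le (norm_nonneg _)
  let c : ℕ → Linfty μ := fun i => star (r ⟨basis μ i, hS i⟩)
  have hc : ∀ n : ℕ, ‖∑ i ∈ Finset.range n, c i * star (c i)‖ ≤ C ^ 2 := by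
    intro n
    -- the test vector is the truncation of the sequence that is to represent `r`
    let z : S := ∑ i ∈ Finset.range n, c i • (⟨basis μ i, hS i⟩ : S)
    have h1 : r z = ∑ i ∈ Finset.range n, c i * star (c i) := by
      rw [map_sum]
      exact Finset.sum_congr rfl fun i _ => by rw [map_smul, smul_eq_mul, star_star]
    have hseq : ∀ i, (z : StdDual μ).seq i = if i < n then c i else 0 := by
      intro i
      simp [z, seq_basis]
    have h2 : trunc n (z : StdDual μ) = z := by
      ext1 i
      rw [seq_trunc, hseq]
      split_ifs <;> rfl
    have h3 : ‖z‖ ^ 2 = ‖∑ i ∈ Finset.range n, c i * star (c i)‖ := by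
      rw [Submodule.coe_norm, ← h2, norm_trunc_sq]
      congr 1
      refine Finset.sum_congr rfl fun i hi => ?_
      rw [hseq, if_pos (Finset.mem_range.1 hi)]
    have h4 := hr z
    rw [h1, ← h3] at h4
    rw [← h3]
    have h5 : ‖z‖ ≤ C := by
      by_contra! h
      nlinarith [norm_nonneg z]
    gcongr
  let y : StdDual μ := ⟨c, C ^ 2, hc⟩
  have hy : ∀ i, y.seq i = c i := fun _ => rfl
  refine ⟨y, fun x => ?_⟩
  let r' : S →ₗ[Linfty μ] Linfty μ :=
    { toFun := fun x => ⟪y, (x : StdDual μ)⟫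
      map_add' := fun x z => by rw [Submodule.coe_add, StdDual.inner_add_right]
      map_smul' := fun a x => by
        rw [Submodule.coe_smul, StdDual.inner_smul_right]
        rfl }
  have h := eq_zero_of_basis hS (r - r') (C := C + ‖y‖) (fun x => ?_) fun j => ?_
  · exact LinearMap.congr_fun (sub_eq_zero.1 h) x
  · rw [LinearMap.sub_apply, add_mul]
    exact (norm_sub_le _ _).trans (add_le_add (hr x) (norm_inner_le_mul y x))
  · rw [LinearMap.sub_apply, sub_eq_zero]
    change _ = ⟪y, basis μ j⟫
    rw [inner_basis_right, hy, star_star]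

theorem basis_mem_stdModule (j : ℕ) : basis μ j ∈ StdModule μ := by
  refine ⟨1, tendsto_const_nhds.congr' ?_⟩
  filter_upwards [eventually_gt_atTop j] with n hn
  symm
  rw [Finset.sum_eq_single_of_mem j (Finset.mem_range.2 hn)]
  · simp [seq_basis]
  · intro i _ hij
    simp [seq_basis, hij]

theorem trunc_mem_stdModule (n : ℕ) (x : StdDual μ) : trunc n x ∈ StdModule μ :=
  Submodule.sum_mem _ fun i _ => Submodule.smul_mem _ _ (basis_mem_stdModule i)

theorem existsUnique_inner_eq (r : StdModule μ →ₗ[Linfty μ] Linfty μ)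
    (hr : ∃ C : ℝ, ∀ x, ‖r x‖ ≤ C * ‖x‖) :
    ∃! y : StdDual μ, ∀ x : StdModule μ, r x = ⟪y, (x : StdDual μ)⟫ := by
  obtain ⟨C, hC⟩ := hr
  obtain ⟨y, hy⟩ := exists_inner_eq basis_mem_stdModule r hC
  refine ⟨y, hy, fun z hz => ?_⟩
  ext1 i
  have h := (hz ⟨basis μ i, basis_mem_stdModule i⟩).symm.trans (hy _)
  rwa [inner_basis_right, inner_basis_right, star_inj] at h

theorem isLeast_norm (y : StdDual μ) : IsLeast
    {C : ℝ | 0 ≤ C ∧ ∀ x : StdModule μ, ‖⟪y, (x : StdDual μ)⟫‖ ≤ C * ‖x‖} ‖y‖ := by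
  refine ⟨⟨norm_nonneg _, fun x => norm_inner_le_mul y x⟩, ?_⟩
  rintro C ⟨hC, h⟩
  refine norm_le_of_norm_trunc_le hC fun n => ?_
  have h1 := h ⟨trunc n y, trunc_mem_stdModule n y⟩
  have h2 : ‖⟪y, trunc n y⟫‖ = ‖trunc n y‖ ^ 2 := by
    rw [norm_trunc_sq, inner_trunc_right]
    simp only [mul_comm]
  rw [h2, Submodule.coe_norm] at h1
  by_contra! h3
  nlinarith [norm_nonneg (trunc n y)]

end StdDual

/-! ### Adjoints of module maps -/

namespace EndA

open StdDual

variable {X : Type*} [MeasurableSpace X] {μ : Measure X}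

local notation "⟪" x ", " y "⟫" => inner (Linfty μ) x y

/-- Every module operator has an adjoint, because `H` is self-dual. -/
theorem exists_adjoint (T : EndA μ) : ∃ R : EndA μ, ‖R‖ ≤ ‖T‖ ∧ ∀ x y : StdDual μ,
    ⟪(R : StdDual μ →L[ℂ] StdDual μ) x, y⟫ = ⟪x, (T : StdDual μ →L[ℂ] StdDual μ) y⟫ := by
  obtain ⟨T, hT⟩ := T
  have h1 : ∀ x : StdDual μ, ∃ z : StdDual μ, ∀ y, ⟪z, y⟫ = ⟪x, T y⟫ := by
    intro x
    let r : (⊤ : Submodule (Linfty μ) (StdDual μ)) →ₗ[Linfty μ] Linfty μ :=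
      { toFun := fun y => ⟪x, T y⟫
        map_add' := fun y z => by
          rw [Submodule.coe_add, map_add, StdDual.inner_add_right]
        map_smul' := fun a y => by
          rw [Submodule.coe_smul, hT, StdDual.inner_smul_right]
          rfl }
    obtain ⟨z, hz⟩ := exists_inner_eq (fun j => Submodule.mem_top) r (C := ‖x‖ * ‖T‖) fun y => by
      refine (norm_inner_le_mul x (T y)).trans ?_
      rw [mul_assoc]
      gcongr
      exact T.le_opNorm y
    exact ⟨z, fun y => (hz ⟨y, Submodule.mem_top⟩).symm⟩
  choose R hR using h1
  have hR' : ∀ x y, ⟪y, R x⟫ = ⟪T y, x⟫ := fun x y => by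
    rw [← StdDual.star_inner, hR, StdDual.star_inner]
  have hnorm : ∀ x, ‖R x‖ ≤ ‖T‖ * ‖x‖ := by
    intro x
    have h2 : ‖R x‖ ^ 2 ≤ ‖x‖ * (‖T‖ * ‖R x‖) := by
      rw [norm_sq_eq_norm_inner, hR]
      refine (norm_inner_le_mul _ _).trans ?_
      gcongr
      exact T.le_opNorm _
    by_contra! h3
    nlinarith [norm_nonneg (R x), mul_nonneg (norm_nonneg T) (norm_nonneg x)]
  let R' : StdDual μ →L[ℂ] StdDual μ := LinearMap.mkContinuous
    { toFun := R
      map_add' := fun x y => eq_of_inner_left fun z => by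
        simp only [hR', StdDual.inner_add_right]
      map_smul' := fun c x => eq_of_inner_left fun z => by
        simp only [hR', StdDual.inner_smul_right_complex, RingHom.id_apply] } ‖T‖ hnorm
  refine ⟨⟨R', fun a x => eq_of_inner_left fun z => ?_⟩,
    ContinuousLinearMap.opNorm_le_bound _ (norm_nonneg _) hnorm, hR⟩
  change ⟪z, R (a • x)⟫ = ⟪z, a • R x⟫
  simp only [hR', StdDual.inner_smul_right]

end EndA

/-! ### The multiplication algebra on `L²` -/

namespace Linfty

variable {X : Type*} [MeasurableSpace X] {μ : Measure X}

/-- The operator of multiplication by an essentially bounded function on `L²(X, μ)`. -/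
noncomputable def mulOp (a : Linfty μ) : Lp ℂ 2 μ →L[ℂ] Lp ℂ 2 μ :=
  LinearMap.mkContinuous
    { toFun := fun f => (a • f : Lp ℂ 2 μ)
      map_add' := fun f g => Lp.add_smul a f g
      map_smul' := fun c f => (Lp.smul_comm c a f).symm } ‖a‖ fun f => Lp.norm_smul_le a f

theorem coeFn_mulOp (a : Linfty μ) (f : Lp ℂ 2 μ) : ⇑(mulOp a f) =ᵐ[μ] fun t => a t * f t :=
  Lp.coeFn_lpSMul a f

/-- The representation of `L^∞(X, μ)` on `L²(X, μ)` by multiplication. -/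
noncomputable def mulHom (μ : Measure X) : Linfty μ →⋆ₐ[ℂ] (Lp ℂ 2 μ →L[ℂ] Lp ℂ 2 μ) where
  toFun := mulOp
  map_one' := by
    ext1 f
    apply Lp.ext
    filter_upwards [coeFn_mulOp 1 f, coeFn_one (μ := μ)] with t h1 h2
    rw [h1, h2, one_mul]
    rfl
  map_mul' a b := by
    ext1 f
    apply Lp.ext
    filter_upwards [coeFn_mulOp (a * b) f, coeFn_mul a b, coeFn_mulOp a (mulOp b f),
      coeFn_mulOp b f] with t h1 h2 h3 h4
    rw [mul_apply_eq_comp, h1, h2, h3, h4, mul_assoc]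
  map_zero' := by
    ext1 f
    exact Lp.zero_smul ℂ ∞ f
  map_add' a b := by
    ext1 f
    exact Lp.smul_add a b f
  commutes' c := by
    ext1 f
    apply Lp.ext
    rw [Algebra.algebraMap_eq_smul_one, Algebra.algebraMap_eq_smul_one, smul_apply,
      one_apply_eq_self]
    filter_upwards [coeFn_mulOp (c • 1) f, Lp.coeFn_smul c (1 : Linfty μ), coeFn_one (μ := μ),
      Lp.coeFn_smul c f] with t h1 h2 h3 h4
    rw [h1, h2, Pi.smul_apply, h3, h4, Pi.smul_apply, smul_eq_mul, smul_eq_mul, mul_one]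
  map_star' a := by
    rw [ContinuousLinearMap.star_eq_adjoint, ContinuousLinearMap.eq_adjoint_iff]
    intro f g
    rw [L2.inner_def, L2.inner_def]
    refine integral_congr_ae ?_
    filter_upwards [coeFn_mulOp (star a) f, coeFn_star a, coeFn_mulOp a g] with t h1 h2 h3
    rw [h1, h2, h3]
    simp only [RCLike.inner_apply, map_mul, Complex.conj_conj]
    ring

theorem coeFn_mulHom (a : Linfty μ) (f : Lp ℂ 2 μ) : ⇑(mulHom μ a f) =ᵐ[μ] fun t => a t * f t :=
  coeFn_mulOp a f

variable (μ) in
/-- For a `σ`-finite measure there is a square integrable function that vanishes nowhere. -/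
theorem exists_L2_pos [SigmaFinite μ] : ∃ e : Lp ℂ 2 μ, ∃ u : X → ℝ, (∀ t, 0 < u t) ∧
    ⇑e =ᵐ[μ] fun t => (u t : ℂ) := by
  obtain ⟨g, hpos, hmeas, hint⟩ := exists_pos_lintegral_lt_of_sigmaFinite μ one_ne_zero
  have hm : Measurable fun t => √(g t : ℝ) := hmeas.coe_nnreal_real.sqrt
  have h : MemLp (fun t => ((√(g t : ℝ) : ℝ) : ℂ)) 2 μ := by
    refine (memLp_two_iff_integrable_sq_norm
      (Complex.measurable_ofReal.comp hm).aestronglyMeasurable).2 ?_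
    have h1 : ∀ t, ‖((√(g t : ℝ) : ℝ) : ℂ)‖ ^ 2 = g t := fun t => by
      rw [Complex.norm_of_nonneg (Real.sqrt_nonneg _), Real.sq_sqrt (g t).coe_nonneg]
    simp only [Function.comp_apply, h1]
    refine ⟨hmeas.coe_nnreal_real.aestronglyMeasurable, ?_⟩
    rw [hasFiniteIntegral_iff_enorm]
    refine lt_of_eq_of_lt (lintegral_congr fun t => ?_) (hint.trans ENNReal.one_lt_top)
    simp
  exact ⟨h.toLp, fun t => √(g t : ℝ), fun t => Real.sqrt_pos.2 (hpos t), h.coeFn_toLp⟩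

theorem norm_sq_eq_integral (f : Lp ℂ 2 μ) : ‖f‖ ^ 2 = ∫ t, ‖f t‖ ^ 2 ∂μ := by
  have h := inner_self_eq_norm_sq_to_K (𝕜 := ℂ) f
  rw [L2.inner_def] at h
  have h1 : (fun t => inner ℂ (f t) (f t)) = fun t => ((‖f t‖ ^ 2 : ℝ) : ℂ) := by
    funext t
    rw [inner_self_eq_norm_sq_to_K]
    push_cast
    rfl
  rw [h1, integral_complex_ofReal] at h
  refine Complex.ofReal_injective ?_
  rw [h]
  push_cast
  rfl

/-- A vector orthogonal to all `b • e`, where `e` vanishes nowhere, is zero. -/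
theorem eq_zero_of_inner_mulHom {e : Lp ℂ 2 μ} {u : X → ℝ} (hu : ∀ t, 0 < u t)
    (he : ⇑e =ᵐ[μ] fun t => (u t : ℂ)) {h : Lp ℂ 2 μ}
    (hh : ∀ b : Linfty μ, inner ℂ h (mulHom μ b e) = 0) : h = 0 := by
  have hm : AEStronglyMeasurable (fun t => ((1 + ‖h t‖ : ℝ) : ℂ)⁻¹ * h t) μ :=
    (((Lp.aestronglyMeasurable h).norm.const_add 1).aemeasurable.complex_ofReal.inv.mul
      (Lp.aestronglyMeasurable h).aemeasurable).aestronglyMeasurable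
  -- the multiplier `h / (1 + ‖h‖)` is bounded, and pairs with `h` to a nonnegative integrand
  have hb : MemLp (fun t => ((1 + ‖h t‖ : ℝ) : ℂ)⁻¹ * h t) ∞ μ := by
    refine memLp_top_of_bound hm 1 (ae_of_all _ fun t => ?_)
    rw [norm_mul, norm_inv, Complex.norm_of_nonneg (by positivity), inv_mul_le_one₀ (by positivity)]
    linarith
  have h1 := hh hb.toLp
  have h3 : ∀ᵐ t ∂μ, inner ℂ (h t) (mulHom μ hb.toLp e t) =
      (((1 + ‖h t‖)⁻¹ * ‖h t‖ ^ 2 * u t : ℝ) : ℂ) := by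
    filter_upwards [coeFn_mulHom hb.toLp e, hb.coeFn_toLp, he] with t h4 h5 h6
    rw [h4, h5, h6]
    have h7 := Complex.mul_conj (h t)
    rw [Complex.normSq_eq_norm_sq] at h7
    push_cast at h7 ⊢
    rw [← h7]
    simp only [RCLike.inner_apply]
    ring
  have h2 := (L2.integrable_inner h (mulHom μ hb.toLp e) : Integrable _ μ).congr h3
  rw [L2.inner_def, integral_congr_ae h3, integral_complex_ofReal] at h1
  have h4 : ∫ t, (1 + ‖h t‖)⁻¹ * ‖h t‖ ^ 2 * u t ∂μ = 0 := by exact_mod_cast h1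
  have h5 : Integrable (fun t => (1 + ‖h t‖)⁻¹ * ‖h t‖ ^ 2 * u t) μ := by
    exact h2.re
  rw [integral_eq_zero_iff_of_nonneg (fun t => by have := (hu t).le; positivity) h5] at h4
  apply Lp.ext
  filter_upwards [h4, Lp.coeFn_zero ℂ 2 μ] with t h6 h7
  rw [h7]
  have h8 : (1 + ‖h t‖)⁻¹ * ‖h t‖ ^ 2 * u t = 0 := h6
  have h9 : (1 + ‖h t‖)⁻¹ ≠ 0 := by positivity
  simpa [h9, (hu t).ne'] using h8

/-- An operator on `L²` that commutes with multiplications maps `e` to a function that is dominated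
by a multiple of `e`: otherwise its norm would be exceeded on the set where that fails. -/
theorem ae_norm_le_of_commute {T : Lp ℂ 2 μ →L[ℂ] Lp ℂ 2 μ}
    (hT : ∀ (a : Linfty μ) (f : Lp ℂ 2 μ), T (mulHom μ a f) = mulHom μ a (T f)) (e : Lp ℂ 2 μ) :
    ∀ᵐ t ∂μ, ‖T e t‖ ≤ ‖T‖ * ‖e t‖ := by
  have hs : MeasurableSet {t | ‖T‖ * ‖e t‖ < ‖T e t‖} :=
    measurableSet_lt ((Lp.stronglyMeasurable _).measurable.norm.const_mul _)
      (Lp.stronglyMeasurable _).measurable.norm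
  set s := {t | ‖T‖ * ‖e t‖ < ‖T e t‖} with hs_def
  have hind : ∀ f : Lp ℂ 2 μ, ‖mulHom μ (ind μ hs) f‖ ^ 2 =
      ∫ t, s.indicator (fun t => ‖f t‖ ^ 2) t ∂μ := by
    intro f
    rw [norm_sq_eq_integral]
    refine integral_congr_ae ?_
    filter_upwards [coeFn_mulHom (ind μ hs) f, coeFn_ind (μ := μ) hs] with t h1 h2
    rw [h1, h2]
    by_cases h : t ∈ s <;> simp [h]
  have hint : ∀ f : Lp ℂ 2 μ, Integrable (s.indicator fun t => ‖f t‖ ^ 2) μ := fun f =>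
    ((memLp_two_iff_integrable_sq_norm (Lp.aestronglyMeasurable f)).1 (Lp.memLp f)).indicator hs
  have h1 : ‖mulHom μ (ind μ hs) (T e)‖ ^ 2 ≤ ‖T‖ ^ 2 * ‖mulHom μ (ind μ hs) e‖ ^ 2 := by
    rw [← hT, ← mul_pow]
    gcongr
    exact T.le_opNorm _
  rw [hind, hind, ← integral_const_mul] at h1
  have hpos : ∀ t, 0 ≤ s.indicator (fun t => ‖T e t‖ ^ 2) t -
      ‖T‖ ^ 2 * s.indicator (fun t => ‖e t‖ ^ 2) t := by
    intro t
    by_cases h : t ∈ s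
    · rw [Set.indicator_of_mem h, Set.indicator_of_mem h, ← mul_pow, sub_nonneg]
      have h2 : ‖T‖ * ‖e t‖ < ‖T e t‖ := h
      gcongr
    · simp [h]
  have h2 : ∫ t, (s.indicator (fun t => ‖T e t‖ ^ 2) t -
      ‖T‖ ^ 2 * s.indicator (fun t => ‖e t‖ ^ 2) t) ∂μ = 0 := by
    refine le_antisymm ?_ (integral_nonneg hpos)
    rw [integral_sub (hint _) ((hint e).const_mul _)]
    linarith
  rw [integral_eq_zero_iff_of_nonneg hpos ((hint _).sub ((hint e).const_mul _))] at h2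
  filter_upwards [h2] with t h3
  by_contra! h4
  have h5 : t ∈ s := h4
  simp only [Pi.zero_apply, Set.indicator_of_mem h5] at h3
  have h6 : (‖T‖ * ‖e t‖) ^ 2 < ‖T e t‖ ^ 2 := by gcongr
  rw [mul_pow] at h6
  linarith

/-- The multiplication operators on `L²` of a `σ`-finite measure are their own commutant. -/
theorem exists_mulHom_eq [SigmaFinite μ] {T : Lp ℂ 2 μ →L[ℂ] Lp ℂ 2 μ}
    (hT : ∀ (a : Linfty μ) (f : Lp ℂ 2 μ), T (mulHom μ a f) = mulHom μ a (T f)) :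
    ∃ a, mulHom μ a = T := by
  obtain ⟨e, u, hu, he⟩ := exists_L2_pos μ
  have ha : MemLp (fun t => T e t / e t) ∞ μ := by
    refine memLp_top_of_bound ((Lp.aestronglyMeasurable (T e)).aemeasurable.div
      (Lp.aestronglyMeasurable e).aemeasurable).aestronglyMeasurable ‖T‖ ?_
    filter_upwards [ae_norm_le_of_commute hT e, he] with t h1 h2
    have h3 : 0 < ‖e t‖ := by
      rw [h2, Complex.norm_of_nonneg (hu t).le]
      exact hu t
    rw [norm_div, div_le_iff₀ h3]
    exact h1
  have hTe : mulHom μ ha.toLp e = T e := by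
    apply Lp.ext
    filter_upwards [coeFn_mulHom ha.toLp e, ha.coeFn_toLp, he] with t h1 h2 h3
    have h4 : e t ≠ 0 := by
      rw [h3]
      exact_mod_cast (hu t).ne'
    rw [h1, h2, div_mul_cancel₀ _ h4]
  have hcomm : ∀ (a b : Linfty μ) (f : Lp ℂ 2 μ),
      mulHom μ a (mulHom μ b f) = mulHom μ b (mulHom μ a f) := fun a b f => by
    rw [← mul_apply_eq_comp, ← mul_apply_eq_comp, ← map_mul, ← map_mul, mul_comm]
  refine ⟨ha.toLp, ?_⟩
  -- both operators agree on the vectors `b • e`, and these are total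
  ext1 f
  refine ext_inner_left ℂ fun k => ?_
  rw [← ContinuousLinearMap.adjoint_inner_left, ← ContinuousLinearMap.adjoint_inner_left]
  congr 1
  rw [← sub_eq_zero]
  refine eq_zero_of_inner_mulHom hu he fun b => ?_
  rw [inner_sub_left, ContinuousLinearMap.adjoint_inner_left,
    ContinuousLinearMap.adjoint_inner_left, hT, hcomm, hTe, sub_self]

theorem mulHom_injective [SigmaFinite μ] : Function.Injective (mulHom μ) := by
  obtain ⟨e, u, hu, he⟩ := exists_L2_pos μ
  intro a b hab
  apply Lp.ext
  have h := DFunLike.congr_fun hab e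
  filter_upwards [coeFn_mulHom a e, coeFn_mulHom b e, he] with t h1 h2 h3
  rw [h, h2] at h1
  have h4 : e t ≠ 0 := by
    rw [h3]
    exact_mod_cast (hu t).ne'
  exact (mul_right_cancel₀ h4 h1).symm

theorem exists_vonNeumannAlgebra_mul [SigmaFinite μ] : ∃ (N : VonNeumannAlgebra (Lp ℂ 2 μ))
    (π : Linfty μ ≃⋆ₐ[ℂ] N.toStarSubalgebra), ∀ (a : Linfty μ) (f : Lp ℂ 2 μ),
      ⇑((π a : Lp ℂ 2 μ →L[ℂ] Lp ℂ 2 μ) f) =ᵐ[μ] fun t => a t * f t := by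
  have hcent : Set.centralizer ((mulHom μ).range : Set (Lp ℂ 2 μ →L[ℂ] Lp ℂ 2 μ)) =
      ((mulHom μ).range : Set (Lp ℂ 2 μ →L[ℂ] Lp ℂ 2 μ)) := by
    ext T
    rw [Set.mem_centralizer_iff]
    constructor
    · intro h
      exact exists_mulHom_eq fun a f => (DFunLike.congr_fun (h _ ⟨a, rfl⟩) f).symm
    · rintro ⟨a, rfl⟩ _ ⟨b, rfl⟩
      change mulHom μ b * mulHom μ a = mulHom μ a * mulHom μ b
      rw [← map_mul, ← map_mul, mul_comm]
  let N : VonNeumannAlgebra (Lp ℂ 2 μ) :=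
    { toStarSubalgebra := (mulHom μ).range
      centralizer_centralizer' := by
        change Set.centralizer (Set.centralizer
          ((mulHom μ).range : Set (Lp ℂ 2 μ →L[ℂ] Lp ℂ 2 μ))) =
            ((mulHom μ).range : Set (Lp ℂ 2 μ →L[ℂ] Lp ℂ 2 μ))
        rw [hcent, hcent] }
  exact ⟨N, StarAlgEquiv.ofInjective (mulHom μ) mulHom_injective, fun a f => coeFn_mulHom a f⟩

end Linfty

/-! ### Realizations as von Neumann algebras are normal -/

section Realization

variable {X : Type*} [MeasurableSpace X] {μ : Measure X}
  {K : Type*} [NormedAddCommGroup K] [InnerProductSpace ℂ K] [CompleteSpace K]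

/-- A `*`-homomorphism of `L^∞(X, μ)` into the bounded operators on `K` that is injective and has
the von Neumann algebra `N` as its range. No continuity is required. -/
structure IsRealization (N : VonNeumannAlgebra K) (ρ : Linfty μ →⋆ₐ[ℂ] (K →L[ℂ] K)) : Prop where
  injective : Function.Injective ρ
  mem_iff : ∀ R, R ∈ N ↔ ∃ a, ρ a = R

namespace IsRealization

variable {N : VonNeumannAlgebra K} {ρ : Linfty μ →⋆ₐ[ℂ] (K →L[ℂ] K)}

theorem norm_map (hρ : IsRealization N ρ) (a : Linfty μ) : ‖ρ a‖ = ‖a‖ :=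
  NonUnitalStarAlgHom.norm_map ρ hρ.injective a

theorem commute (hρ : IsRealization N ρ) {R : K →L[ℂ] K} (hR : R ∈ N.commutant)
    (a : Linfty μ) (w : K) : R (ρ a w) = ρ a (R w) :=
  (DFunLike.congr_fun (VonNeumannAlgebra.mem_commutant_iff.1 hR _ ((hρ.mem_iff _).2 ⟨a, rfl⟩))
    w).symm

theorem mem_of_commute {R : K →L[ℂ] K} (h : ∀ Z ∈ N.commutant, ∀ w, Z (R w) = R (Z w)) :
    R ∈ N := by
  rw [← N.commutant_commutant, VonNeumannAlgebra.mem_commutant_iff]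
  intro Z hZ
  ext w
  exact h Z hZ w

/-- A realization is normal on exhaustions: the vectors `w` with `ρ (p n) w → w` form a closed
subspace that is invariant under the commutant, so the projection onto it is `ρ q` for some `q`
with `q * p n = p n` for all `n`, and such a `q` is `1`. -/
theorem tendsto_exhaustion (hρ : IsRealization N ρ) {p : ℕ → Linfty μ}
    (hp : Linfty.IsExhaustion p) (w : K) : Tendsto (fun n => ρ (p n) w) atTop (𝓝 w) := by
  have hle : ∀ n (v : K), ‖ρ (p n) v‖ ≤ ‖v‖ := fun n v => by
    refine ((ρ (p n)).le_opNorm v).trans (mul_le_of_le_one_left (norm_nonneg v) ?_)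
    rw [hρ.norm_map]
    exact hp.norm_le_one n
  let W : Submodule ℂ K :=
    { carrier := {v | Tendsto (fun n => ρ (p n) v) atTop (𝓝 v)}
      zero_mem' := by simp
      add_mem' := fun {u v} hu hv => by simpa using Tendsto.add hu hv
      smul_mem' := fun c v hv => by simpa using Tendsto.const_smul hv c }
  have hWmem : ∀ v, v ∈ W ↔ Tendsto (fun n => ρ (p n) v) atTop (𝓝 v) := fun _ => Iff.rfl
  have hclosed : IsClosed (W : Set K) := by
    refine isClosed_of_closure_subset fun v hv => ?_
    change Tendsto _ _ _
    rw [Metric.tendsto_atTop]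
    intro ε hε
    obtain ⟨u, hu, huv⟩ := Metric.mem_closure_iff.1 hv (ε / 3) (by positivity)
    obtain ⟨n0, hn0⟩ := Metric.tendsto_atTop.1 ((hWmem u).1 hu) (ε / 3) (by positivity)
    refine ⟨n0, fun n hn => ?_⟩
    have h1 := hn0 n hn
    have h2 := hle n (v - u)
    rw [dist_eq_norm] at h1 huv ⊢
    have h3 : ρ (p n) v - v = ρ (p n) (v - u) + (ρ (p n) u - u) - (v - u) := by
      rw [map_sub]; abel
    rw [h3]
    have h4 := norm_sub_le (ρ (p n) (v - u) + (ρ (p n) u - u)) (v - u)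
    have h5 := norm_add_le (ρ (p n) (v - u)) (ρ (p n) u - u)
    linarith
  have : CompleteSpace W := hclosed.completeSpace_coe
  have hQ : W.starProjection ∈ N := by
    rw [VonNeumannAlgebra.IsStarProjection.mem_iff isStarProjection_starProjection]
    intro Z hZ
    rw [Submodule.range_starProjection, Module.End.mem_invtSubmodule]
    intro v hv
    change Tendsto (fun n => ρ (p n) (Z v)) atTop (𝓝 (Z v))
    simp only [← hρ.commute hZ]
    exact (Z.continuous.tendsto v).comp ((hWmem v).1 hv)
  obtain ⟨q, hq⟩ := (hρ.mem_iff _).1 hQ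
  have hqp : ∀ n, q * p n = p n := by
    intro n
    apply hρ.injective
    ext v
    rw [map_mul, hq]
    refine W.starProjection_eq_self_iff.2 ?_
    refine tendsto_const_nhds.congr' ?_
    filter_upwards [eventually_ge_atTop n] with m hm
    change ρ (p n) v = (ρ (p m) * ρ (p n)) v
    rw [← map_mul, hp.mul_eq n m hm]
  have hq1 : q = 1 := by
    refine sub_eq_zero.1 (hp.eq_zero fun n => ?_)
    rw [mul_sub, mul_comm, hqp, mul_one, sub_self]
  rw [hq1, map_one] at hq
  have h : W.starProjection w = w := by rw [← hq]; rfl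
  exact (hWmem w).1 (W.starProjection_eq_self_iff.1 h)

open StdDual in
/-- A realization is normal on the series that define the inner product. -/
theorem tendsto_inner_trunc (hρ : IsRealization N ρ) (x y : StdDual μ) (w : K) :
    Tendsto (fun n => ρ (inner (Linfty μ) x (trunc n y)) w) atTop
      (𝓝 (ρ (inner (Linfty μ) x y) w)) := by
  rw [Metric.tendsto_atTop]
  intro δ hδ
  obtain ⟨p, hp, hpy⟩ := exists_isExhaustion y (ε := δ / (2 * (‖x‖ * ‖w‖ + 1))) (by positivity)
  obtain ⟨n0, hn0⟩ := Metric.tendsto_atTop.1 (hρ.tendsto_exhaustion hp w)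
    (δ / (2 * (‖x‖ * (2 * ‖y‖) + 1))) (by positivity)
  refine ⟨n0, fun n hn => ?_⟩
  set d := y - trunc n y with hd
  have hdy : ‖d‖ ≤ 2 * ‖y‖ := by
    rw [two_mul]
    exact (norm_sub_le _ _).trans (add_le_add le_rfl (norm_trunc_le n y))
  have h1 : ρ (inner (Linfty μ) x y) w - ρ (inner (Linfty μ) x (trunc n y)) w =
      ρ (inner (Linfty μ) x (p n • d)) w - ρ (inner (Linfty μ) x d) (ρ (p n) w - w) := by
    rw [StdDual.inner_smul_right, mul_comm, map_mul, map_sub, mul_apply_eq_comp,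
      sub_sub_cancel, hd, StdDual.inner_sub_right, map_sub]
    rfl
  have h2 : ‖ρ (inner (Linfty μ) x (p n • d)) w‖ ≤
      ‖x‖ * (δ / (2 * (‖x‖ * ‖w‖ + 1))) * ‖w‖ := by
    refine ((ρ _).le_opNorm w).trans ?_
    rw [hρ.norm_map]
    gcongr
    refine (norm_inner_le_mul _ _).trans ?_
    gcongr
    exact hpy n
  have h3 : ‖ρ (inner (Linfty μ) x d) (ρ (p n) w - w)‖ ≤
      ‖x‖ * (2 * ‖y‖) * (δ / (2 * (‖x‖ * (2 * ‖y‖) + 1))) := by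
    refine ((ρ _).le_opNorm _).trans ?_
    rw [hρ.norm_map, ← dist_eq_norm (ρ (p n) w) w]
    gcongr
    · refine (norm_inner_le_mul _ _).trans ?_
      gcongr
    · exact (hn0 n hn).le
  have key : ∀ s : ℝ, 0 ≤ s → s * (δ / (2 * (s + 1))) < δ / 2 := by
    intro s hs
    rw [mul_div_assoc', div_lt_div_iff₀ (by positivity) (by positivity)]
    nlinarith
  rw [dist_comm, dist_eq_norm, h1]
  have h4 := key (‖x‖ * ‖w‖) (by positivity)
  have h5 := key (‖x‖ * (2 * ‖y‖)) (by positivity)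
  have h6 : ‖x‖ * (δ / (2 * (‖x‖ * ‖w‖ + 1))) * ‖w‖ =
    ‖x‖ * ‖w‖ * (δ / (2 * (‖x‖ * ‖w‖ + 1))) := by ring
  rw [h6] at h2
  exact (norm_sub_le _ _).trans_lt (by linarith)

end IsRealization

end Realization

/-! ### The coordinates of the Hilbert space tensor product -/

section Coordinates

variable (K : Type*) [NormedAddCommGroup K] [InnerProductSpace ℂ K]

/-- The Hilbert space tensor product of `l²` and `K`. -/
abbrev L2Tensor : Type _ := UniformSpace.Completion (l2 ⊗[ℂ] K)

variable {K}

/-- The elementary tensor `a ⊗ w` in the Hilbert space tensor product, as a function of `a`. -/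
noncomputable def tmulRight (w : K) : l2 →L[ℂ] L2Tensor K :=
  UniformSpace.Completion.toComplL.comp ((TensorProduct.mkL ℂ l2 K).flip w)

theorem tmulRight_apply (a : l2) (w : K) :
    tmulRight w a = ((a ⊗ₜ[ℂ] w : l2 ⊗[ℂ] K) : L2Tensor K) := rfl

variable (K) in
/-- The isometry `w ↦ e_k ⊗ w`, where `e_k` is the `k`-th standard basis vector of `l²`. -/
noncomputable def place (k : ℕ) : K →ₗᵢ[ℂ] L2Tensor K where
  toLinearMap := (UniformSpace.Completion.toComplL.comp
    (TensorProduct.mkL ℂ l2 K (lp.single 2 k (1 : ℂ)))).toLinearMap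
  norm_map' w := by
    change ‖(((lp.single 2 k (1 : ℂ) : l2) ⊗ₜ[ℂ] w : l2 ⊗[ℂ] K) : L2Tensor K)‖ = ‖w‖
    rw [UniformSpace.Completion.norm_coe, TensorProduct.norm_tmul,
      lp.norm_single (by norm_num), norm_one, one_mul]

theorem place_apply (k : ℕ) (w : K) :
    place K k w = (((lp.single 2 k (1 : ℂ) : l2) ⊗ₜ[ℂ] w : l2 ⊗[ℂ] K) : L2Tensor K) := rfl

theorem inner_place_place (i j : ℕ) (v w : K) :
    inner ℂ (place K i v) (place K j w) = if i = j then inner ℂ v w else 0 := by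
  rw [place_apply, place_apply, UniformSpace.Completion.inner_coe, TensorProduct.inner_tmul,
    lp.inner_single_left]
  rw [lp.single_apply]
  split_ifs with h
  · subst h; simp
  · simp [h]

variable (K) in
theorem orthogonalFamily_place : OrthogonalFamily ℂ (fun _ : ℕ => K) (place K) := by
  intro i j hij v w
  rw [inner_place_place, if_neg hij]

theorem eq_of_inner_place {f g : L2Tensor K}
    (h : ∀ k w, inner ℂ (place K k w) f = inner ℂ (place K k w) g) : f = g := by
  refine (UniformSpace.Completion.denseRange_coe (α := l2 ⊗[ℂ] K)).eq_of_inner_right ℂ ?_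
  intro t
  induction t using TensorProduct.induction_on with
  | zero => rw [UniformSpace.Completion.coe_zero, inner_zero_left, inner_zero_left]
  | add s t hs ht => rw [UniformSpace.Completion.coe_add, inner_add_left, inner_add_left, hs, ht]
  | tmul a w =>
    have h1 : HasSum (fun k => tmulRight w (lp.single 2 k (a k))) (tmulRight w a) :=
      (lp.hasSum_single (by norm_num) a).mapL (tmulRight w)
    have h2 : ∀ k, tmulRight w (lp.single 2 k (a k)) = place K k (a k • w) := by
      intro k
      rw [tmulRight_apply, place_apply, ← TensorProduct.smul_tmul, ← lp.single_smul, smul_eq_mul,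
        mul_one]
    rw [funext h2, tmulRight_apply] at h1
    have h3 : ∀ g : L2Tensor K, HasSum (fun k => inner ℂ (place K k (a k • w)) g)
        (inner ℂ ((a ⊗ₜ[ℂ] w : l2 ⊗[ℂ] K) : L2Tensor K) g) := fun g => by
      have := (h1.mapL (innerSL ℂ g)).map (starRingEnd ℂ) Complex.continuous_conj
      simpa [Function.comp_def, inner_smul_left] using this
    have h4 := h3 f
    simp only [h] at h4
    exact h4.unique (h3 g)

/-- Operators on the Hilbert space tensor product are determined by their values on the vectors
`e_k ⊗ w`. -/
theorem ext_place {A B : L2Tensor K →L[ℂ] L2Tensor K}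
    (h : ∀ k w, A (place K k w) = B (place K k w)) : A = B := by
  ext f
  refine ext_inner_left ℂ fun g => ?_
  rw [← ContinuousLinearMap.adjoint_inner_left, ← ContinuousLinearMap.adjoint_inner_left]
  congr 1
  refine eq_of_inner_place fun k w => ?_
  rw [ContinuousLinearMap.adjoint_inner_right, ContinuousLinearMap.adjoint_inner_right, h]

end Coordinates

/-! ### The operators `K → l² ⊗ K` defined by sequences -/

section Creation

open StdDual

variable {X : Type*} [MeasurableSpace X] {μ : Measure X}
  {K : Type*} [NormedAddCommGroup K] [InnerProductSpace ℂ K] [CompleteSpace K]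
  (ρ : Linfty μ →⋆ₐ[ℂ] (K →L[ℂ] K))

theorem inner_map_star (a : Linfty μ) (v w : K) :
    inner ℂ v (ρ (star a) w) = inner ℂ (ρ a v) w := by
  rw [map_star, ContinuousLinearMap.star_eq_adjoint, ContinuousLinearMap.adjoint_inner_right]

theorem inner_map_inner_trunc (n : ℕ) (x y : StdDual μ) (v w : K) :
    inner ℂ v (ρ (inner (Linfty μ) x (trunc n y)) w) =
      ∑ k ∈ Finset.range n, inner ℂ (ρ (x.seq k) v) (ρ (y.seq k) w) := by
  rw [inner_trunc_right, map_sum, sum_apply, inner_sum]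
  refine Finset.sum_congr rfl fun k _ => ?_
  rw [map_mul, mul_apply_eq_comp, inner_map_star]

theorem sum_norm_sq_le (n : ℕ) (x : StdDual μ) (w : K) :
    ∑ k ∈ Finset.range n, ‖ρ (x.seq k) w‖ ^ 2 ≤ (‖x‖ * ‖w‖) ^ 2 := by
  have h1 : ((∑ k ∈ Finset.range n, ‖ρ (x.seq k) w‖ ^ 2 : ℝ) : ℂ) =
      inner ℂ w (ρ (inner (Linfty μ) x (trunc n x)) w) := by
    rw [inner_map_inner_trunc]
    push_cast
    exact Finset.sum_congr rfl fun k _ =>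
      (inner_self_eq_norm_sq_to_K (𝕜 := ℂ) (ρ (x.seq k) w)).symm
  have h2 : ∑ k ∈ Finset.range n, ‖ρ (x.seq k) w‖ ^ 2 =
      ‖inner ℂ w (ρ (inner (Linfty μ) x (trunc n x)) w)‖ := by
    rw [← h1, Complex.norm_of_nonneg (Finset.sum_nonneg fun k _ => by positivity)]
  rw [h2]
  calc _ ≤ ‖w‖ * ‖ρ (inner (Linfty μ) x (trunc n x)) w‖ := norm_inner_le_norm _ _
    _ ≤ ‖w‖ * (‖x‖ * ‖x‖ * ‖w‖) := by
        gcongr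
        refine ((ρ _).le_opNorm w).trans ?_
        gcongr
        refine (NonUnitalStarAlgHom.norm_apply_le ρ _).trans ((norm_inner_le_mul _ _).trans ?_)
        gcongr
        exact norm_trunc_le n x
    _ = _ := by ring

theorem summable_place (x : StdDual μ) (w : K) :
    Summable fun k => place K k (ρ (x.seq k) w) := by
  rw [(orthogonalFamily_place K).summable_iff_norm_sq_summable]
  exact summable_of_sum_range_le (fun k => by positivity) fun n => sum_norm_sq_le ρ n x w

/-- The operator `w ↦ ∑ k, e_k ⊗ ρ (x k) w` from `K` to `l² ⊗ K` that a sequence `x` in `H`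
defines. -/
noncomputable def creation (x : StdDual μ) : K →L[ℂ] L2Tensor K :=
  LinearMap.mkContinuous
    { toFun := fun w => ∑' k, place K k (ρ (x.seq k) w)
      map_add' := fun v w => by
        simp only [map_add]
        exact (summable_place ρ x v).tsum_add (summable_place ρ x w)
      map_smul' := fun c w => by
        simp only [map_smul, RingHom.id_apply]
        exact (summable_place ρ x w).tsum_const_smul c } ‖x‖ fun w => by
    refine le_of_tendsto (summable_place ρ x w).hasSum.tendsto_sum_nat.norm
      (Eventually.of_forall fun n => ?_)
    refine le_of_sq_le_sq ?_ (by positivity)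
    rw [(orthogonalFamily_place K).norm_sum]
    exact sum_norm_sq_le ρ n x w

theorem hasSum_creation (x : StdDual μ) (w : K) :
    HasSum (fun k => place K k (ρ (x.seq k) w)) (creation ρ x w) :=
  (summable_place ρ x w).hasSum

theorem norm_creation_le (x : StdDual μ) : ‖creation ρ x‖ ≤ ‖x‖ :=
  LinearMap.mkContinuous_norm_le _ (norm_nonneg _) _

theorem inner_place_creation (k : ℕ) (x : StdDual μ) (v w : K) :
    inner ℂ (place K k v) (creation ρ x w) = inner ℂ v (ρ (x.seq k) w) := by
  have h1 := (hasSum_creation ρ x w).mapL (innerSL ℂ (place K k v))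
  simp only [innerSL_apply_apply, inner_place_place] at h1
  refine h1.unique ?_
  convert! hasSum_single k fun j hj => if_neg hj.symm using 1
  rw [if_pos rfl]

theorem creation_add (x y : StdDual μ) : creation ρ (x + y) = creation ρ x + creation ρ y := by
  ext w
  refine eq_of_inner_place fun k v => ?_
  rw [add_apply, inner_add_right, inner_place_creation,
    inner_place_creation, inner_place_creation, seq_add, map_add, add_apply,
    inner_add_right]

theorem creation_smul (c : ℂ) (x : StdDual μ) : creation ρ (c • x) = c • creation ρ x := by
  ext w
  refine eq_of_inner_place fun k v => ?_
  rw [smul_apply, inner_smul_right, inner_place_creation,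
    inner_place_creation, seq_smul_complex, map_smul, smul_apply, inner_smul_right]

theorem creation_smul_apply (a : Linfty μ) (x : StdDual μ) (w : K) :
    creation ρ (a • x) w = creation ρ x (ρ a w) := by
  refine eq_of_inner_place fun k v => ?_
  rw [inner_place_creation, inner_place_creation, seq_smul, mul_comm, map_mul, mul_apply_eq_comp]

theorem creation_basis (j : ℕ) (w : K) : creation ρ (basis μ j) w = place K j w := by
  refine eq_of_inner_place fun k v => ?_
  rw [inner_place_creation, inner_place_place, seq_basis]
  split_ifs <;> simp

variable {ρ} in
/-- If `Z` acts on the vectors `e_k ⊗ w` as `1 ⊗ R`, with `R` in the commutant of the range of `ρ`,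
then `Z` intertwines the operators of sequences with `R`. -/
theorem map_creation {Z : L2Tensor K →L[ℂ] L2Tensor K} {R : K →L[ℂ] K}
    (hZ : ∀ k w, Z (place K k w) = place K k (R w)) (hR : ∀ a w, R (ρ a w) = ρ a (R w))
    (x : StdDual μ) (w : K) : Z (creation ρ x w) = creation ρ x (R w) := by
  have h1 := (hasSum_creation ρ x w).mapL Z
  simp only [hZ, hR] at h1
  exact h1.unique (hasSum_creation ρ x (R w))

variable {ρ} {N : VonNeumannAlgebra K}

/-- The inner product of `H` becomes the inner product of `l² ⊗ K`. This needs that realizations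
are normal, since the series for `⟨x, y⟩` converges only almost everywhere. -/
theorem inner_creation_creation (hρ : IsRealization N ρ) (x y : StdDual μ) (v w : K) :
    inner ℂ (creation ρ x v) (creation ρ y w) = inner ℂ v (ρ (inner (Linfty μ) x y) w) := by
  have h1 := ((hasSum_creation ρ y w).mapL (innerSL ℂ (creation ρ x v))).tendsto_sum_nat
  have h2 := (innerSL ℂ v).continuous.tendsto _ |>.comp (hρ.tendsto_inner_trunc x y w)
  refine tendsto_nhds_unique h1 (h2.congr fun n => ?_)
  simp only [Function.comp_apply, innerSL_apply_apply, inner_map_inner_trunc]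
  refine Finset.sum_congr rfl fun k _ => ?_
  rw [← inner_conj_symm (creation ρ x v), inner_place_creation, inner_conj_symm]

theorem norm_creation (hρ : IsRealization N ρ) (x : StdDual μ) : ‖creation ρ x‖ = ‖x‖ := by
  refine le_antisymm (norm_creation_le ρ x) (le_of_sq_le_sq ?_ (norm_nonneg (creation ρ x)))
  have h1 : (creation ρ x).adjoint ∘L creation ρ x = ρ (inner (Linfty μ) x x) := by
    ext w
    refine ext_inner_left ℂ fun v => ?_
    rw [ContinuousLinearMap.comp_apply, ContinuousLinearMap.adjoint_inner_right,
      inner_creation_creation hρ]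
  rw [norm_sq_eq_norm_inner, ← hρ.norm_map, ← h1, ContinuousLinearMap.norm_adjoint_comp_self, sq]

theorem creation_injective (hρ : IsRealization N ρ) {x y : StdDual μ}
    (h : ∀ w, creation ρ x w = creation ρ y w) : x = y := by
  ext1 i
  refine hρ.injective ?_
  ext w
  refine ext_inner_left ℂ fun v => ?_
  rw [← inner_place_creation, h, inner_place_creation]

/-- The operators of sequences are the operators `V` whose coordinates `(e_k ⊗ ·)* V` lie
in the von Neumann algebra. -/
theorem exists_creation_eq (hρ : IsRealization N ρ) (V : K →L[ℂ] L2Tensor K)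
    (hV : ∀ k, (place K k).toContinuousLinearMap.adjoint ∘L V ∈ N) :
    ∃ x : StdDual μ, creation ρ x = V := by
  choose c hc using fun k => (hρ.mem_iff _).1 (hV k)
  have hc' : ∀ k v w, inner ℂ v (ρ (c k) w) = inner ℂ (place K k v) (V w) := fun k v w => by
    rw [hc, ContinuousLinearMap.comp_apply, ContinuousLinearMap.adjoint_inner_right]
    rfl
  have hbound : ∀ n : ℕ, ‖∑ i ∈ Finset.range n, c i * star (c i)‖ ≤ ‖V‖ ^ 2 := by
    intro n
    rw [← hρ.norm_map]
    have h1 : ∀ w, V.adjoint (∑ i ∈ Finset.range n, place K i (ρ (c i) w)) =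
        ρ (∑ i ∈ Finset.range n, c i * star (c i)) w := by
      intro w
      refine ext_inner_left ℂ fun v => ?_
      rw [ContinuousLinearMap.adjoint_inner_right, inner_sum, map_sum,
        sum_apply, inner_sum]
      refine Finset.sum_congr rfl fun i _ => ?_
      rw [mul_comm, map_mul, mul_apply_eq_comp, inner_map_star,
        ← inner_conj_symm (V v), ← hc', inner_conj_symm]
    -- Bessel's inequality for the coordinates of `V w`
    have h2 : ∀ w, ‖∑ i ∈ Finset.range n, place K i (ρ (c i) w)‖ ≤ ‖V w‖ := by
      intro w
      set s := ∑ i ∈ Finset.range n, place K i (ρ (c i) w) with hs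
      have h3 : inner ℂ s s = inner ℂ s (V w) := by
        conv_lhs => rw [hs, (orthogonalFamily_place K).inner_sum]
        rw [hs, sum_inner]
        exact Finset.sum_congr rfl fun i _ => hc' i _ w
      have h4 := norm_inner_le_norm (𝕜 := ℂ) s (V w)
      rw [← h3, inner_self_eq_norm_sq_to_K] at h4
      by_contra! h5
      simp only [norm_pow, Complex.coe_algebraMap, Complex.norm_real, norm_norm] at h4
      nlinarith [norm_nonneg (V w)]
    refine ContinuousLinearMap.opNorm_le_bound _ (by positivity) fun w => ?_
    rw [← h1]
    calc _ ≤ ‖V.adjoint‖ * ‖∑ i ∈ Finset.range n, place K i (ρ (c i) w)‖ := V.adjoint.le_opNorm _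
      _ ≤ ‖V‖ * (‖V‖ * ‖w‖) := by
          rw [LinearIsometryEquiv.norm_map]
          gcongr
          exact (h2 w).trans (V.le_opNorm w)
      _ = _ := by ring
  let x : StdDual μ := ⟨c, ‖V‖ ^ 2, hbound⟩
  refine ⟨x, ?_⟩
  ext w
  refine eq_of_inner_place fun k v => ?_
  rw [inner_place_creation]
  exact hc' k v w

end Creation

/-! ### The commutant of the W*-tensor product -/

section Ampliation

variable {K : Type*} [NormedAddCommGroup K] [InnerProductSpace ℂ K]

theorem completion_mapL_place (S : l2 →L[ℂ] l2) (R : K →L[ℂ] K) (k : ℕ) (w : K) :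
    (TensorProduct.mapL S R).completion (place K k w) =
      tmulRight (R w) (S (lp.single 2 k (1 : ℂ))) := by
  rw [place_apply, tmulRight_apply, ContinuousLinearMap.completion_apply_coe,
    TensorProduct.mapL_tmul]

theorem completion_mapL_id_place (R : K →L[ℂ] K) (k : ℕ) (w : K) :
    (TensorProduct.mapL (ContinuousLinearMap.id ℂ l2) R).completion (place K k w) =
      place K k (R w) :=
  completion_mapL_place _ _ _ _

/-- The matrix unit of `l²` that maps `e_j` to `e_i`. -/
noncomputable def matrixUnit (i j : ℕ) : l2 →L[ℂ] l2 :=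
  (innerSL ℂ (lp.single 2 j (1 : ℂ) : l2)).smulRight (lp.single 2 i (1 : ℂ))

theorem completion_mapL_matrixUnit_place (i j k : ℕ) (w : K) :
    (TensorProduct.mapL (matrixUnit i j) (ContinuousLinearMap.id ℂ K)).completion (place K k w) =
      if k = j then place K i w else 0 := by
  rw [completion_mapL_place, matrixUnit, ContinuousLinearMap.smulRight_apply, innerSL_apply_apply,
    lp.inner_single_left, lp.single_apply]
  split_ifs with h
  · subst h
    simp [tmulRight_apply, place_apply]
  · simp [Pi.single_eq_of_ne' h]

variable [CompleteSpace K]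

/-- Adjoints of elementary tensors of operators; with it the commutant of the generators of the
tensor product is closed under adjoints. -/
theorem star_completion_mapL (S : l2 →L[ℂ] l2) (R : K →L[ℂ] K) :
    star (TensorProduct.mapL S R).completion =
      (TensorProduct.mapL (star S) (star R)).completion := by
  refine ext_place fun j w => ?_
  refine eq_of_inner_place fun i v => ?_
  rw [ContinuousLinearMap.star_eq_adjoint, ContinuousLinearMap.adjoint_inner_right,
    completion_mapL_place, completion_mapL_place, place_apply, place_apply, tmulRight_apply,
    tmulRight_apply, UniformSpace.Completion.inner_coe, UniformSpace.Completion.inner_coe,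
    TensorProduct.inner_tmul, TensorProduct.inner_tmul, ContinuousLinearMap.star_eq_adjoint,
    ContinuousLinearMap.star_eq_adjoint, ContinuousLinearMap.adjoint_inner_right,
    ContinuousLinearMap.adjoint_inner_right]

variable {N : VonNeumannAlgebra K}

/-- The tensor product is the commutant of the commutant of the elementary tensors. -/
theorem mem_tensor_iff {S : L2Tensor K →L[ℂ] L2Tensor K} :
    S ∈ (VonNeumannAlgebra.full l2).tensor N ↔ ∀ Z : L2Tensor K →L[ℂ] L2Tensor K,
      (∀ A : l2 →L[ℂ] l2, ∀ R ∈ N, (TensorProduct.mapL A R).completion * Z =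
        Z * (TensorProduct.mapL A R).completion) → Z * S = S * Z := by
  have key : ∀ Z : L2Tensor K →L[ℂ] L2Tensor K, Z ∈ StarSubalgebra.centralizer ℂ
      {T | ∃ A ∈ VonNeumannAlgebra.full l2, ∃ R ∈ N, T = (TensorProduct.mapL A R).completion} ↔
      ∀ A : l2 →L[ℂ] l2, ∀ R ∈ N, (TensorProduct.mapL A R).completion * Z =
        Z * (TensorProduct.mapL A R).completion := by
    intro Z
    rw [StarSubalgebra.mem_centralizer_iff]
    constructor
    · intro h A R hR
      exact (h _ ⟨A, trivial, R, hR, rfl⟩).1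
    · rintro h _ ⟨A, -, R, hR, rfl⟩
      refine ⟨h A R hR, ?_⟩
      rw [star_completion_mapL]
      exact h (star A) (star R) (star_mem hR)
  change S ∈ StarSubalgebra.centralizer ℂ (StarSubalgebra.centralizer ℂ
      {T | ∃ A ∈ VonNeumannAlgebra.full l2, ∃ R ∈ N, T = (TensorProduct.mapL A R).completion} :
      Set (L2Tensor K →L[ℂ] L2Tensor K)) ↔ _
  rw [StarSubalgebra.mem_centralizer_iff]
  constructor
  · intro h Z hZ
    exact (h Z ((key Z).2 hZ)).1
  · intro h Z hZ
    exact ⟨h Z ((key Z).1 hZ), h _ ((key _).1 (star_mem hZ))⟩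

/-- The operators `1 ⊗ R`, with `R` in the commutant of `N`, commute with the tensor product. -/
theorem completion_mapL_id_commute {S : L2Tensor K →L[ℂ] L2Tensor K}
    (hS : S ∈ (VonNeumannAlgebra.full l2).tensor N) {R : K →L[ℂ] K} (hR : R ∈ N.commutant)
    (f : L2Tensor K) :
    (TensorProduct.mapL (ContinuousLinearMap.id ℂ l2) R).completion (S f) =
      S ((TensorProduct.mapL (ContinuousLinearMap.id ℂ l2) R).completion f) := by
  refine DFunLike.congr_fun (mem_tensor_iff.1 hS
    (TensorProduct.mapL (ContinuousLinearMap.id ℂ l2) R).completion fun A Q hQ => ?_) f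
  refine ext_place fun k w => ?_
  have h : Q (R w) = R (Q w) := DFunLike.congr_fun (VonNeumannAlgebra.mem_commutant_iff.1 hR Q hQ) w
  rw [mul_apply_eq_comp, mul_apply_eq_comp, completion_mapL_id_place, completion_mapL_place,
    completion_mapL_place, h, tmulRight_apply, tmulRight_apply,
    ContinuousLinearMap.completion_apply_coe, TensorProduct.mapL_tmul]
  rfl

/-- An operator that commutes with `A ⊗ R` for all `A` and all `R ∈ N` is of the form `1 ⊗ Q` with
`Q` in the commutant of `N`. -/
theorem exists_commutant_of_commute {Z : L2Tensor K →L[ℂ] L2Tensor K}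
    (hZ : ∀ A : l2 →L[ℂ] l2, ∀ R ∈ N, (TensorProduct.mapL A R).completion * Z =
        Z * (TensorProduct.mapL A R).completion) :
    ∃ Q ∈ N.commutant, ∀ k w, Z (place K k w) = place K k (Q w) := by
  have hZ' : ∀ (A : l2 →L[ℂ] l2), ∀ R ∈ N, ∀ f, (TensorProduct.mapL A R).completion (Z f) =
      Z ((TensorProduct.mapL A R).completion f) := fun A R hR f =>
    DFunLike.congr_fun (hZ A R hR) f
  let Q : K →L[ℂ] K := (place K 0).toContinuousLinearMap.adjoint ∘L
    (Z ∘L (place K 0).toContinuousLinearMap)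
  have hQ : ∀ v w, inner ℂ v (Q w) = inner ℂ (place K 0 v) (Z (place K 0 w)) := fun v w => by
    rw [ContinuousLinearMap.comp_apply, ContinuousLinearMap.adjoint_inner_right]
    rfl
  have hmem : ContinuousLinearMap.id ℂ K ∈ N := one_mem N
  have hplace : ∀ k w, Z (place K k w) = place K k (Q w) := by
    intro k w
    have h1 : place K k w = (TensorProduct.mapL (matrixUnit k 0)
        (ContinuousLinearMap.id ℂ K)).completion (place K 0 w) := by
      rw [completion_mapL_matrixUnit_place, if_pos rfl]
    have h2 : star (matrixUnit k 0) = matrixUnit 0 k := by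
      ext a : 1
      refine ext_inner_left ℂ fun b => ?_
      rw [ContinuousLinearMap.star_eq_adjoint, ContinuousLinearMap.adjoint_inner_right]
      simp only [matrixUnit, ContinuousLinearMap.smulRight_apply, innerSL_apply_apply,
        inner_smul_left, inner_smul_right, inner_conj_symm]
      ring
    rw [h1, ← hZ' _ _ hmem]
    refine eq_of_inner_place fun i v => ?_
    rw [← ContinuousLinearMap.adjoint_inner_left, ← ContinuousLinearMap.star_eq_adjoint,
      star_completion_mapL, h2]
    have h3 : star (ContinuousLinearMap.id ℂ K) = ContinuousLinearMap.id ℂ K :=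
      star_one (K →L[ℂ] K)
    rw [h3, completion_mapL_matrixUnit_place, inner_place_place]
    split_ifs with h
    · rw [hQ]
    · rw [inner_zero_left]
  refine ⟨Q, VonNeumannAlgebra.mem_commutant_iff.2 fun R hR => ?_, hplace⟩
  ext w
  apply (place K 0).injective
  change place K 0 (R (Q w)) = place K 0 (Q (R w))
  rw [← hplace, ← completion_mapL_id_place, ← completion_mapL_id_place R, ← hplace, hZ' _ _ hR]

end Ampliation

/-! ### Bounded operators from symmetric maps -/

/-- Let `J` map into a Hilbert space and let `D` be symmetric for the semi-inner product that `J`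
defines. If the orbit of each vector under `D` grows at most like `r ^ n`, then `D` is bounded by
`r`: the norms along an orbit are log-convex, so their first quotient is at most their growth
rate. -/
theorem norm_le_of_symmetric_of_growth {V E : Type*} [AddCommGroup V] [Module ℂ V]
    [NormedAddCommGroup E] [InnerProductSpace ℂ E] (J : V →ₗ[ℂ] E) (D : V →ₗ[ℂ] V)
    (hsymm : ∀ f g, inner ℂ (J (D f)) (J g) = inner ℂ (J f) (J (D g))) {r : ℝ} (hr : 0 ≤ r)
    (hgrowth : ∀ f, ∃ C, ∀ n : ℕ, ‖J ((D ^ n) f)‖ ≤ C * r ^ n) (f : V) :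
    ‖J (D f)‖ ≤ r * ‖J f‖ := by
  obtain ⟨C, hC⟩ := hgrowth f
  set a : ℕ → ℝ := fun n => ‖J ((D ^ n) f)‖ with ha
  have ha0 : ∀ n, 0 ≤ a n := fun n => norm_nonneg _
  have hconv : ∀ n, a (n + 1) ^ 2 ≤ a n * a (n + 2) := by
    intro n
    have h1 : ‖inner ℂ (J ((D ^ (n + 1)) f)) (J ((D ^ (n + 1)) f))‖ = a (n + 1) ^ 2 := by
      rw [inner_self_eq_norm_sq_to_K]
      simp [ha]
    rw [← h1]
    have h2 : (D ^ (n + 1)) f = D ((D ^ n) f) := by rw [pow_succ']; rfl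
    have h3 : (D ^ (n + 2)) f = D ((D ^ (n + 1)) f) := by rw [pow_succ']; rfl
    conv_lhs => rw [h2, hsymm, ← h2, ← h3]
    exact norm_inner_le_norm _ _
  have h0 : a 0 = ‖J f‖ := by simp [ha]
  have h1 : a 1 = ‖J (D f)‖ := by simp [ha]
  rw [← h0, ← h1]
  by_contra! hlt
  have h1pos : 0 < a 1 := (mul_nonneg hr (ha0 0)).trans_lt hlt
  have h0pos : 0 < a 0 := by
    refine (ha0 0).lt_of_ne fun h => ?_
    have := hconv 0
    rw [← h, zero_mul] at this
    nlinarith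
  obtain ⟨q, hq⟩ : ∃ q, q = a 1 / a 0 := ⟨_, rfl⟩
  have hqpos : 0 < q := hq ▸ div_pos h1pos h0pos
  have hrq : r < q := by rw [hq, lt_div_iff₀ h0pos]; exact hlt
  have hstep : ∀ n, 0 < a n ∧ q * a n ≤ a (n + 1) := by
    intro n
    induction n with
    | zero => exact ⟨h0pos, by rw [hq, div_mul_cancel₀ _ h0pos.ne']⟩
    | succ n ih =>
      obtain ⟨h2, h3⟩ := ih
      have h4 : 0 < a (n + 1) := (mul_pos hqpos h2).trans_le h3
      refine ⟨h4, ?_⟩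
      have h5 := hconv n
      have h6 : a n * (q * a (n + 1)) ≤ a n * a (n + 2) := by nlinarith
      exact le_of_mul_le_mul_left h6 h2
  have hpow : ∀ n, a 0 * q ^ n ≤ a n := by
    intro n
    induction n with
    | zero => simp
    | succ n ih =>
      calc a 0 * q ^ (n + 1) = q * (a 0 * q ^ n) := by ring
        _ ≤ q * a n := by gcongr
        _ ≤ a (n + 1) := (hstep n).2
  have h2 : Tendsto (fun n : ℕ => C * (r / q) ^ n) atTop (𝓝 (C * 0)) :=
    (tendsto_pow_atTop_nhds_zero_of_lt_one (by positivity) ((div_lt_one hqpos).2 hrq)).const_mul C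
  have h3 : a 0 ≤ C * 0 := by
    refine ge_of_tendsto h2 (Eventually.of_forall fun n => ?_)
    rw [div_pow, mul_div_assoc', le_div_iff₀ (by positivity)]
    exact (hpow n).trans (hC n)
  linarith

/-! ### Module operators as operators on the tensor product -/

namespace EndA

open StdDual

variable {X : Type*} [MeasurableSpace X] {μ : Measure X}
  {K : Type*} [NormedAddCommGroup K] [InnerProductSpace ℂ K] [CompleteSpace K]
  {N : VonNeumannAlgebra K} {ρ : Linfty μ →⋆ₐ[ℂ] (K →L[ℂ] K)}

/-- An operator of the tensor product maps operators of sequences to operators of sequences, and so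
it defines a module operator. -/
theorem exists_of_mem_tensor (hρ : IsRealization N ρ) {S : L2Tensor K →L[ℂ] L2Tensor K}
    (hS : S ∈ (VonNeumannAlgebra.full l2).tensor N) :
    ∃ T : EndA μ, ‖T‖ ≤ ‖S‖ ∧ ∀ (x : StdDual μ) (w : K),
      creation ρ ((T : StdDual μ →L[ℂ] StdDual μ) x) w = S (creation ρ x w) := by
  have h1 : ∀ x : StdDual μ, ∃ y : StdDual μ, creation ρ y = S ∘L creation ρ x := by
    intro x
    refine exists_creation_eq hρ _ fun k => IsRealization.mem_of_commute fun Z hZ w => ?_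
    refine ext_inner_left ℂ fun v => ?_
    have hamp : ∀ w, (TensorProduct.mapL (ContinuousLinearMap.id ℂ l2) Z).completion
        (creation ρ x w) = creation ρ x (Z w) := fun w =>
      map_creation (completion_mapL_id_place Z) (fun a w => hρ.commute hZ a w) x w
    have hadj : (TensorProduct.mapL (ContinuousLinearMap.id ℂ l2) Z).completion.adjoint
        (place K k v) = place K k (Z.adjoint v) := by
      have h2 := star_completion_mapL (ContinuousLinearMap.id ℂ l2) Z
      have h3 : star (ContinuousLinearMap.id ℂ l2) = ContinuousLinearMap.id ℂ l2 :=
        star_one (l2 →L[ℂ] l2)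
      rw [← ContinuousLinearMap.star_eq_adjoint, h2, h3, completion_mapL_id_place]
      rfl
    rw [← ContinuousLinearMap.adjoint_inner_left]
    simp only [ContinuousLinearMap.comp_apply, ContinuousLinearMap.adjoint_inner_right]
    rw [← hamp, ← completion_mapL_id_commute hS hZ]
    change inner ℂ (place K k (Z.adjoint v)) _ = inner ℂ (place K k v) _
    rw [← hadj, ContinuousLinearMap.adjoint_inner_left]
  choose T hT using h1
  have hT' : ∀ x w, creation ρ (T x) w = S (creation ρ x w) := fun x w => by rw [hT]; rfl
  have hnorm : ∀ x, ‖T x‖ ≤ ‖S‖ * ‖x‖ := fun x => by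
    rw [← norm_creation hρ, ← norm_creation hρ x, hT]
    exact ContinuousLinearMap.opNorm_comp_le _ _
  refine ⟨⟨LinearMap.mkContinuous
    { toFun := T
      map_add' := fun x y => creation_injective hρ fun w => ?_
      map_smul' := fun c x => creation_injective hρ fun w => ?_ } ‖S‖ hnorm, fun a x =>
        creation_injective hρ fun w => ?_⟩, ?_, hT'⟩
  · rw [creation_add, add_apply, hT', hT', hT', creation_add, add_apply, map_add]
  · rw [RingHom.id_apply, creation_smul, smul_apply, hT', hT', creation_smul, smul_apply, map_smul]
  · change creation ρ (T (a • x)) w = creation ρ (a • T x) w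
    rw [creation_smul_apply, hT', hT', creation_smul_apply]
  · exact LinearMap.mkContinuous_norm_le _ (norm_nonneg S) hnorm

variable (ρ) in
/-- The linear map `x ⊗ w ↦ creation ρ x w` from the algebraic tensor product of `H` and `K`. -/
noncomputable def creationLift : StdDual μ ⊗[ℂ] K →ₗ[ℂ] L2Tensor K :=
  TensorProduct.lift (LinearMap.mk₂ ℂ (fun x w => creation ρ x w)
    (fun x y w => by rw [creation_add, add_apply])
    (fun c x w => by rw [creation_smul, smul_apply])
    (fun x v w => map_add _ v w) (fun c x w => map_smul _ c w))

theorem creationLift_tmul (x : StdDual μ) (w : K) :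
    creationLift ρ (x ⊗ₜ w) = creation ρ x w := rfl

theorem denseRange_creationLift : DenseRange (creationLift (μ := μ) ρ) := by
  have h : (LinearMap.range (creationLift (μ := μ) ρ)).topologicalClosure = ⊤ := by
    rw [Submodule.topologicalClosure_eq_top_iff, Submodule.eq_bot_iff]
    intro f hf
    refine eq_of_inner_place fun k w => ?_
    rw [inner_zero_right, ← creation_basis (μ := μ) ρ, ← creationLift_tmul]
    exact hf _ (LinearMap.mem_range_self _ _)
  exact Submodule.dense_iff_topologicalClosure_eq_top.2 h

theorem inner_creationLift_rTensor (hρ : IsRealization N ρ) {R T : EndA μ}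
    (hRT : ∀ x y : StdDual μ, inner (Linfty μ) ((R : StdDual μ →L[ℂ] StdDual μ) x) y =
      inner (Linfty μ) x ((T : StdDual μ →L[ℂ] StdDual μ) y)) (f g : StdDual μ ⊗[ℂ] K) :
    inner ℂ (creationLift ρ ((R : StdDual μ →L[ℂ] StdDual μ).toLinearMap.rTensor K f))
      (creationLift ρ g) = inner ℂ (creationLift ρ f)
        (creationLift ρ ((T : StdDual μ →L[ℂ] StdDual μ).toLinearMap.rTensor K g)) := by
  induction f using TensorProduct.induction_on with
  | zero => simp only [map_zero, inner_zero_left]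
  | add f₁ f₂ h₁ h₂ => simp only [map_add, inner_add_left, h₁, h₂]
  | tmul x v =>
    induction g using TensorProduct.induction_on with
    | zero => simp only [map_zero, inner_zero_right]
    | add g₁ g₂ h₁ h₂ => simp only [map_add, inner_add_right, h₁, h₂]
    | tmul y w =>
      rw [LinearMap.rTensor_tmul, LinearMap.rTensor_tmul, creationLift_tmul, creationLift_tmul,
        creationLift_tmul, creationLift_tmul, inner_creation_creation hρ,
        inner_creation_creation hρ]
      exact congrArg (fun a => inner ℂ v (ρ a w)) (hRT x y)

theorem norm_creationLift_rTensor_pow_le (T : EndA μ) (f : StdDual μ ⊗[ℂ] K) :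
    ∃ C, ∀ n : ℕ, ‖creationLift ρ
      (((T : StdDual μ →L[ℂ] StdDual μ).toLinearMap.rTensor K ^ n) f)‖ ≤ C * ‖T‖ ^ n := by
  induction f using TensorProduct.induction_on with
  | zero => exact ⟨0, fun n => by simp only [map_zero, norm_zero, zero_mul, le_refl]⟩
  | add f₁ f₂ h₁ h₂ =>
    obtain ⟨C₁, h₁⟩ := h₁
    obtain ⟨C₂, h₂⟩ := h₂
    refine ⟨C₁ + C₂, fun n => ?_⟩
    rw [map_add, map_add, add_mul]
    exact (norm_add_le _ _).trans (add_le_add (h₁ n) (h₂ n))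
  | tmul x w =>
    refine ⟨‖x‖ * ‖w‖, fun n => ?_⟩
    have h1 : ((T : StdDual μ →L[ℂ] StdDual μ).toLinearMap.rTensor K ^ n) (x ⊗ₜ w) =
        (((T : StdDual μ →L[ℂ] StdDual μ)^[n] x) ⊗ₜ w) := by
      induction n with
      | zero => rfl
      | succ n ih =>
        rw [pow_succ', Module.End.mul_apply, ih, LinearMap.rTensor_tmul,
          Function.iterate_succ_apply']
        rfl
    have h2 : ∀ m, ‖(T : StdDual μ →L[ℂ] StdDual μ)^[m] x‖ ≤ ‖T‖ ^ m * ‖x‖ := by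
      intro m
      induction m with
      | zero => simp
      | succ m ih =>
        rw [Function.iterate_succ_apply', pow_succ', mul_assoc]
        refine ((T : StdDual μ →L[ℂ] StdDual μ).le_opNorm _).trans ?_
        exact mul_le_mul_of_nonneg_left ih (norm_nonneg T)
    rw [h1, creationLift_tmul]
    calc _ ≤ ‖creation ρ ((T : StdDual μ →L[ℂ] StdDual μ)^[n] x)‖ * ‖w‖ :=
          (creation ρ _).le_opNorm w
      _ ≤ ‖T‖ ^ n * ‖x‖ * ‖w‖ := by
          gcongr
          exact (norm_creation_le ρ _).trans (h2 n)
      _ = _ := by ring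

/-- Every module operator comes from an operator of the tensor product, with control of the
norm. -/
theorem exists_mem_tensor (hρ : IsRealization N ρ) (T : EndA μ) :
    ∃ S ∈ (VonNeumannAlgebra.full l2).tensor N, ‖S‖ ≤ ‖T‖ ∧ ∀ (x : StdDual μ) (w : K),
      creation ρ ((T : StdDual μ →L[ℂ] StdDual μ) x) w = S (creation ρ x w) := by
  obtain ⟨R, hRnorm, hR⟩ := exists_adjoint T
  have hbound : ∀ f, ‖creationLift ρ ((T : StdDual μ →L[ℂ] StdDual μ).toLinearMap.rTensor K f)‖ ≤
      ‖T‖ * ‖creationLift ρ f‖ := by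
    intro f
    -- the bound for `T` follows from that for the symmetric operator `R * T`, where `R = T*`
    have h1 := norm_le_of_symmetric_of_growth (creationLift ρ)
      (((R * T : EndA μ) : StdDual μ →L[ℂ] StdDual μ).toLinearMap.rTensor K)
      (inner_creationLift_rTensor hρ fun x y => by
        change inner (Linfty μ) ((R : StdDual μ →L[ℂ] StdDual μ)
          ((T : StdDual μ →L[ℂ] StdDual μ) x)) y = inner (Linfty μ) x
            ((R : StdDual μ →L[ℂ] StdDual μ) ((T : StdDual μ →L[ℂ] StdDual μ) y))
        rw [hR, ← StdDual.star_inner, ← hR, StdDual.star_inner])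
      (norm_nonneg (R * T)) (norm_creationLift_rTensor_pow_le (R * T)) f
    have h2 : (((R * T : EndA μ) : StdDual μ →L[ℂ] StdDual μ).toLinearMap.rTensor K) f =
        (R : StdDual μ →L[ℂ] StdDual μ).toLinearMap.rTensor K
          ((T : StdDual μ →L[ℂ] StdDual μ).toLinearMap.rTensor K f) :=
      LinearMap.rTensor_comp_apply K _ _ f
    have h3 : ‖R * T‖ ≤ ‖T‖ * ‖T‖ := (norm_mul_le R T).trans (by gcongr)
    set b := creationLift ρ ((T : StdDual μ →L[ℂ] StdDual μ).toLinearMap.rTensor K f) with hb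
    set a := creationLift ρ f with ha
    have h4 : ‖b‖ ^ 2 ≤ (‖T‖ * ‖a‖) ^ 2 := by
      have h5 : ‖inner ℂ b b‖ = ‖b‖ ^ 2 := by
        rw [inner_self_eq_norm_sq_to_K]
        simp
      rw [← h5]
      rw [← inner_creationLift_rTensor hρ hR, ← h2]
      calc _ ≤ _ * ‖a‖ := norm_inner_le_norm _ _
        _ ≤ ‖T‖ * ‖T‖ * ‖a‖ * ‖a‖ := by
            gcongr
            exact h1.trans (by gcongr)
        _ = _ := by ring
    exact le_of_sq_le_sq h4 (by positivity)
  let S : L2Tensor K →L[ℂ] L2Tensor K := LinearMap.extendOfNorm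
    (creationLift ρ ∘ₗ (T : StdDual μ →L[ℂ] StdDual μ).toLinearMap.rTensor K) (creationLift ρ)
  have hS : ∀ (x : StdDual μ) (w : K),
      S (creation ρ x w) = creation ρ ((T : StdDual μ →L[ℂ] StdDual μ) x) w := fun x w =>
    LinearMap.extendOfNorm_eq denseRange_creationLift ⟨‖T‖, hbound⟩ (x ⊗ₜ w)
  refine ⟨S, mem_tensor_iff.2 fun Z hZ => ?_, LinearMap.opNorm_extendOfNorm_le
    denseRange_creationLift (norm_nonneg T) hbound, fun x w => (hS x w).symm⟩
  obtain ⟨Q, hQ, hZQ⟩ := exists_commutant_of_commute hZ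
  have hZc := map_creation hZQ (fun a w => hρ.commute hQ a w)
  refine ext_place fun k w => ?_
  rw [mul_apply_eq_comp, mul_apply_eq_comp, hZQ, ← creation_basis (μ := μ) ρ,
    ← creation_basis (μ := μ) ρ, hS, hS, hZc]

variable (ρ) in
theorem ext_creation {A B : L2Tensor K →L[ℂ] L2Tensor K}
    (h : ∀ (x : StdDual μ) (w : K), A (creation ρ x w) = B (creation ρ x w)) : A = B :=
  ext_place fun k w => by rw [← creation_basis (μ := μ) ρ, h]

/-- The algebra of module operators is the W*-tensor product: `Φ T` is the operator with
`Φ T (x ⊗ w) = T x ⊗ w`, where `x ⊗ w` stands for `creation ρ x w`. -/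
theorem exists_algEquiv_tensor (hρ : IsRealization N ρ) :
    ∃ Φ : EndA μ ≃ₐ[ℂ] ((VonNeumannAlgebra.full l2).tensor N).toStarSubalgebra,
      (∀ T : EndA μ, ‖Φ T‖ = ‖T‖) ∧ ∀ (T : EndA μ) (x : StdDual μ) (w : K),
        (Φ T : L2Tensor K →L[ℂ] L2Tensor K) (creation ρ x w) =
          creation ρ ((T : StdDual μ →L[ℂ] StdDual μ) x) w := by
  choose F hFmem hFnorm hF using exists_mem_tensor (μ := μ) hρ
  have hadd : ∀ S T, F (S + T) = F S + F T := fun S T => ext_creation ρ fun x w => by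
    rw [add_apply, ← hF, ← hF, ← hF, Subalgebra.coe_add, add_apply, creation_add, add_apply]
  have hsmul : ∀ (c : ℂ) T, F (c • T) = c • F T := fun c T => ext_creation ρ fun x w => by
    rw [smul_apply, ← hF, ← hF, Subalgebra.coe_smul, smul_apply, creation_smul, smul_apply]
  have hone : F 1 = 1 := ext_creation ρ fun x w => by
    rw [← hF, Subalgebra.coe_one, one_apply_eq_self, one_apply_eq_self]
  have hmul : ∀ S T, F (S * T) = F S * F T := fun S T => ext_creation ρ fun x w => by
    rw [mul_apply_eq_comp, ← hF, ← hF, ← hF, Subalgebra.coe_mul, mul_apply_eq_comp]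
  let L : EndA μ →ₗ[ℂ] ((VonNeumannAlgebra.full l2).tensor N).toStarSubalgebra :=
    { toFun := fun T => ⟨F T, hFmem T⟩
      map_add' := fun S T => Subtype.ext (hadd S T)
      map_smul' := fun c T => Subtype.ext (hsmul c T) }
  let Ψ : EndA μ →ₐ[ℂ] ((VonNeumannAlgebra.full l2).tensor N).toStarSubalgebra :=
    AlgHom.ofLinearMap L (Subtype.ext hone) (fun S T => Subtype.ext (hmul S T))
  have hinj : Function.Injective Ψ := by
    intro S T hST
    have h : F S = F T := congrArg Subtype.val hST
    refine Subtype.ext (ContinuousLinearMap.ext fun x => creation_injective hρ fun w => ?_)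
    rw [hF, h, hF]
  have hsurj : Function.Surjective Ψ := by
    intro S
    obtain ⟨T, -, hT⟩ := exists_of_mem_tensor hρ S.2
    have h : F T = S := ext_creation ρ fun x w => by rw [← hF, hT]
    exact ⟨T, Subtype.ext h⟩
  obtain ⟨Φ, hΦ⟩ : ∃ Φ : EndA μ ≃ₐ[ℂ] ((VonNeumannAlgebra.full l2).tensor N).toStarSubalgebra,
      ∀ T, (Φ T : L2Tensor K →L[ℂ] L2Tensor K) = F T :=
    ⟨AlgEquiv.ofBijective Ψ ⟨hinj, hsurj⟩, fun T => rfl⟩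
  refine ⟨Φ, fun T => ?_, fun T x w => by rw [hΦ, hF]⟩
  change ‖(Φ T : L2Tensor K →L[ℂ] L2Tensor K)‖ = ‖T‖
  rw [hΦ]
  refine le_antisymm (hFnorm T) ?_
  obtain ⟨T', hnorm, hT'⟩ := exists_of_mem_tensor hρ (hFmem T)
  have h : T' = T := Subtype.ext (ContinuousLinearMap.ext fun x =>
    creation_injective hρ fun w => by rw [hT', hF])
  rwa [h] at hnorm

/-- Adjoints of operators on the tensor product correspond to adjoints of module operators. -/
theorem eq_adjoint_iff (hρ : IsRealization N ρ) {A B : L2Tensor K →L[ℂ] L2Tensor K}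
    {S T : StdDual μ →L[ℂ] StdDual μ} (hA : ∀ x w, A (creation ρ x w) = creation ρ (S x) w)
    (hB : ∀ x w, B (creation ρ x w) = creation ρ (T x) w) :
    A = B.adjoint ↔
      ∀ x y : StdDual μ, inner (Linfty μ) (S x) y = inner (Linfty μ) x (T y) := by
  constructor
  · intro h x y
    refine hρ.injective (ContinuousLinearMap.ext fun w => ext_inner_left ℂ fun v => ?_)
    rw [← inner_creation_creation hρ, ← inner_creation_creation hρ, ← hA, ← hB, h,
      ContinuousLinearMap.adjoint_inner_left]
  · intro h
    refine ext_creation ρ fun x w => eq_of_inner_place fun k v => ?_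
    rw [← creation_basis (μ := μ) ρ, hA, inner_creation_creation hρ,
      ContinuousLinearMap.adjoint_inner_right, hB, inner_creation_creation hρ,
      ← StdDual.star_inner, h, StdDual.star_inner]

/-- The matrix entries of the operator on the tensor product are those of the module operator. -/
theorem inner_place_map_place {A : L2Tensor K →L[ℂ] L2Tensor K} {T : StdDual μ →L[ℂ] StdDual μ}
    (hA : ∀ x w, A (creation ρ x w) = creation ρ (T x) w) (i j : ℕ) (v w : K) :
    inner ℂ (place K i v) (A (place K j w)) = inner ℂ v (ρ ((T (basis μ j)).seq i) w) := by
  rw [← creation_basis (μ := μ) ρ j, hA, inner_place_creation]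

end EndA

theorem isRealization_of_starAlgEquiv {X : Type*} [MeasurableSpace X] {μ : Measure X}
    {K : Type*} [NormedAddCommGroup K] [InnerProductSpace ℂ K] [CompleteSpace K]
    {N : VonNeumannAlgebra K} (π : Linfty μ ≃⋆ₐ[ℂ] N.toStarSubalgebra) :
    IsRealization N (N.toStarSubalgebra.subtype.comp π.toStarAlgHom) where
  injective _ _ h := π.injective (Subtype.ext h)
  mem_iff R := by
    constructor
    · intro hR
      exact ⟨π.symm ⟨R, hR⟩, congrArg Subtype.val (π.apply_symm_apply ⟨R, hR⟩)⟩
    · rintro ⟨a, rfl⟩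
      exact (π a).2

theorem exists_algEquiv_tensor_of_starAlgEquiv {X : Type*} [MeasurableSpace X] (μ : Measure X)
    {K : Type*} [NormedAddCommGroup K] [InnerProductSpace ℂ K] [CompleteSpace K]
    (N : VonNeumannAlgebra K) (π : Linfty μ ≃⋆ₐ[ℂ] N.toStarSubalgebra) :
    ∃ Φ : EndA μ ≃ₐ[ℂ] ((VonNeumannAlgebra.full l2).tensor N).toStarSubalgebra,
      (∀ T : EndA μ, ‖Φ T‖ = ‖T‖) ∧
      (∀ S T : EndA μ, Φ S = star (Φ T) ↔
        ∀ x y : StdDual μ, inner (Linfty μ) ((S : StdDual μ →L[ℂ] StdDual μ) x) y =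
          inner (Linfty μ) x ((T : StdDual μ →L[ℂ] StdDual μ) y)) ∧
      ∀ (T : EndA μ) (i j : ℕ) (v w : K),
        inner ℂ (place K i v) ((Φ T : L2Tensor K →L[ℂ] L2Tensor K) (place K j w)) =
          inner ℂ v ((π (((T : StdDual μ →L[ℂ] StdDual μ) (StdDual.basis μ j)).seq i) :
            K →L[ℂ] K) w) := by
  have hρ := isRealization_of_starAlgEquiv π
  obtain ⟨Φ, hnorm, hΦ⟩ := EndA.exists_algEquiv_tensor hρ
  refine ⟨Φ, hnorm, fun S T => ?_, fun T => EndA.inner_place_map_place (hΦ T)⟩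
  exact Subtype.ext_iff.trans (EndA.eq_adjoint_iff hρ (hΦ S) (hΦ T))

theorem corollary2p4 {X : Type*} [MeasurableSpace X] (μ : Measure X) :
    -- `StdDual μ` is the `A`-dual of `l²(A)`: the bounded module maps are the `⟨·, y⟩`, isometrically
    ((∀ r : StdModule μ →ₗ[Linfty μ] Linfty μ, (∃ C : ℝ, ∀ x, ‖r x‖ ≤ C * ‖x‖) →
        ∃! y : StdDual μ, ∀ x : StdModule μ, r x = inner (Linfty μ) y (x : StdDual μ)) ∧
      ∀ y : StdDual μ, IsLeast
        {C : ℝ | 0 ≤ C ∧ ∀ x : StdModule μ, ‖inner (Linfty μ) y (x : StdDual μ)‖ ≤ C * ‖x‖} ‖y‖) ∧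
    -- for σ-finite `μ`, multiplication realizes `A` as a von Neumann algebra on `L²(X, μ)`
    (SigmaFinite μ → ∃ (N : VonNeumannAlgebra (Lp ℂ 2 μ))
        (π : Linfty μ ≃⋆ₐ[ℂ] N.toStarSubalgebra), ∀ (a : Linfty μ) (f : Lp ℂ 2 μ),
        ⇑((π a : Lp ℂ 2 μ →L[ℂ] Lp ℂ 2 μ) f) =ᵐ[μ] fun t => a t * f t) ∧
    -- `End_A(H)` is `End(l²) ⊗̄ A`, for every realization of `A` as a von Neumann algebra
    (∀ {K : Type*} [NormedAddCommGroup K] [InnerProductSpace ℂ K] [CompleteSpace K]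
        (N : VonNeumannAlgebra K) (π : Linfty μ ≃⋆ₐ[ℂ] N.toStarSubalgebra),
      ∃ Φ : EndA μ ≃ₐ[ℂ] ((VonNeumannAlgebra.full l2).tensor N).toStarSubalgebra,
        (∀ T : EndA μ, ‖Φ T‖ = ‖T‖) ∧
        (∀ S T : EndA μ, Φ S = star (Φ T) ↔
          ∀ x y : StdDual μ, inner (Linfty μ) ((S : StdDual μ →L[ℂ] StdDual μ) x) y =
            inner (Linfty μ) x ((T : StdDual μ →L[ℂ] StdDual μ) y)) ∧
        ∀ (T : EndA μ) (i j : ℕ) (v w : K),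
          inner ℂ (((lp.single 2 i (1 : ℂ) : l2) ⊗ₜ[ℂ] v : l2 ⊗[ℂ] K) :
              UniformSpace.Completion (l2 ⊗[ℂ] K))
            ((Φ T : UniformSpace.Completion (l2 ⊗[ℂ] K) →L[ℂ]
                UniformSpace.Completion (l2 ⊗[ℂ] K))
              (((lp.single 2 j (1 : ℂ) : l2) ⊗ₜ[ℂ] w : l2 ⊗[ℂ] K) :
                UniformSpace.Completion (l2 ⊗[ℂ] K))) =
          inner ℂ v ((π (((T : StdDual μ →L[ℂ] StdDual μ) (StdDual.basis μ j)).seq i) :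
            K →L[ℂ] K) w)) :=
  ⟨⟨StdDual.existsUnique_inner_eq, StdDual.isLeast_norm⟩,
    fun _ => Linfty.exists_vonNeumannAlgebra_mul,
    fun N π => exists_algEquiv_tensor_of_starAlgEquiv μ N π⟩
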